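/- Let $n,p\in\mathbb N$ and $h>0$, and let $A\in\mathbb R^{n\times n}$ and $B\in\mathbb R^{p\times p}$ be symmetric positive definite matrices. Let $w_1,\dots,w_n>0$ and $\mu_1,\dots,\mu_p>0$ be such that $w_1^2,\dots,w_n^2$ are the eigenvalues of $A$ and $\mu_1^2,\dots,\mu_p^2$ are the eigenvalues of $B$, listed with multiplicity. Let $V(x,y)=\langle Ax,x\rangle+\langle By,y\rangle$ for $(x,y)\in\mathbb R^n\times\mathbb R^p$, and consider on the complex Hilbert space $L^2(\mathbb R^n\times\mathbb R^p)$ the operator $$H(h)=-h^2\Delta_x-\Delta_y+V,\qquad D(H(h))=\{u\in H^2(\mathbb R^n\times\mathbb R^p):\ Vu\in L^2(\mathbb R^n\times\mathbb R^p)\},$$ where the derivatives are taken in the sense of distributions. The spectrum $\sigma(H(h))$ is the set of all $\lambda\in\mathbb C$ for which $H(h)-\lambda:D(H(h))\to L^2$ is not a bijection with bounded inverse. The discrete spectrum $\sigma_{disc}(H(h))$ is the set of all eigenvalues of finite algebraic multiplicity that are isolated points of $\sigma(H(h))$, where the algebraic multiplicity of $\lambda$ is the dimension of $\bigcup_{k\ge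 1}\ker (H(h)-\lambda)^k$. Then the spectrum of $H(h)$ is purely discrete, and $$\sigma(H(h))=\sigma_{disc}(H(h))=\Big\{\sum_{i=1}^n(2n_i+1)\,h\,w_i+\sum_{j=1}^p(2m_j+1)\,\mu_j\ :\ n_1,\dots,n_n,\,m_1,\dots,m_p\in\{0,1,2,\dots\}\Big\}.$$ -/

import Mathlib

open MeasureTheory TemperedDistribution
open scoped Matrix SchwartzMap LineDeriv

noncomputable section

namespace BornOppenheimer

/-! ### Spectral notions for an unbounded operator -/

section Spectral

variable {X : Type*} [NormedAddCommGroup X] [InnerProductSpace ℂ X]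

/-- `z` lies in the resolvent set of `A`: the operator `A - z : D(A) → X` is bijective and its
inverse `R` is bounded on `X`. -/
def IsResolventPoint (A : X →ₗ.[ℂ] X) (z : ℂ) : Prop :=
  ∃ R : X →L[ℂ] X,
    (∀ v : X, ∃ hv : R v ∈ A.domain, A ⟨R v, hv⟩ - z • R v = v) ∧
    ∀ u : A.domain, R (A u - z • (u : X)) = u

/-- The spectrum of an unbounded operator: the complement of the resolvent set. -/
def opSpectrum (A : X →ₗ.[ℂ] X) : Set ℂ := {z | ¬ IsResolventPoint A z}

/-- `z` is an eigenvalue of `A`: `ker (A - z) ≠ {0}`. -/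
def IsEigenvalue (A : X →ₗ.[ℂ] X) (z : ℂ) : Prop :=
  ∃ u : A.domain, u ≠ 0 ∧ A u = z • (u : X)

/-- `ker (A - z) ^ k`: a vector `u` lies in `ker (A - z) ^ (k + 1)` if and only if `u` lies in
`D(A)` and `(A - z) u` lies in `ker (A - z) ^ k`. -/
def genKernel (A : X →ₗ.[ℂ] X) (z : ℂ) : ℕ → Submodule ℂ X
  | 0 => ⊥
  | k + 1 => ((genKernel A z k).comap (A.toFun - z • A.domain.subtype)).map A.domain.subtype

/-- `⋃ k, ker (A - z) ^ k` (an increasing union); its dimension is the algebraic multiplicity of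
the eigenvalue `z`. -/
def rootSpace (A : X →ₗ.[ℂ] X) (z : ℂ) : Submodule ℂ X := ⨆ k, genKernel A z k

/-- The discrete spectrum: the eigenvalues of finite algebraic multiplicity that are isolated
points of the spectrum. -/
def discreteSpectrum (A : X →ₗ.[ℂ] X) : Set ℂ :=
  {z | z ∈ opSpectrum A ∧ IsEigenvalue A z ∧ FiniteDimensional ℂ (rootSpace A z) ∧
    ∃ ε > (0 : ℝ), ∀ z' ∈ opSpectrum A, dist z' z < ε → z' = z}

end Spectral

/-! ### The Hamiltonian on `L²(ℝⁿ × ℝᵖ)` -/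

/-- The space `ℝⁿ × ℝᵖ` with its Euclidean norm and Lebesgue measure. -/
abbrev Config (n p : ℕ) : Type :=
  WithLp 2 (EuclideanSpace ℝ (Fin n) × EuclideanSpace ℝ (Fin p))

/-- The Hilbert space `L²(ℝⁿ × ℝᵖ)` of complex-valued functions. -/
abbrev L2 (n p : ℕ) : Type := Lp ℂ 2 (volume : Measure (Config n p))

/-- The unit vector of the coordinate `x_i`. -/
def dirX (n p : ℕ) (i : Fin n) : Config n p := WithLp.toLp 2 (EuclideanSpace.single i 1, 0)

/-- The unit vector of the coordinate `y_j`. -/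
def dirY (n p : ℕ) (j : Fin p) : Config n p := WithLp.toLp 2 (0, EuclideanSpace.single j 1)

/-- `-h² Δ_x f - Δ_y f` in the sense of distributions. -/
def kinetic {n p : ℕ} (h : ℝ) (f : 𝓢'(Config n p, ℂ)) : 𝓢'(Config n p, ℂ) :=
  -((h : ℂ) ^ 2 • ∑ i : Fin n, ∂_{dirX n p i} (∂_{dirX n p i} f)) -
    ∑ j : Fin p, ∂_{dirY n p j} (∂_{dirY n p j} f)

theorem kinetic_add {n p : ℕ} (h : ℝ) (f g : 𝓢'(Config n p, ℂ)) :
    kinetic h (f + g) = kinetic h f + kinetic h g := by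
  simp only [kinetic, LineDeriv.lineDerivOp_add, Finset.sum_add_distrib, smul_add]
  abel

theorem kinetic_smul {n p : ℕ} (h : ℝ) (c : ℂ) (f : 𝓢'(Config n p, ℂ)) :
    kinetic h (c • f) = c • kinetic h f := by
  simp only [kinetic, LineDeriv.lineDerivOp_smul, smul_sub, smul_neg, Finset.smul_sum,
    smul_comm c]

/-- `-h² Δ_x - Δ_y` maps the Sobolev space `H²` into `L²`. -/
theorem exists_kinetic_eq {n p : ℕ} (h : ℝ) {f : 𝓢'(Config n p, ℂ)} (hf : MemSobolev 2 2 f) :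
    ∃ g : L2 n p, kinetic h f = (g : 𝓢'(Config n p, ℂ)) := by
  have key (m : Config n p) : MemSobolev 0 2 (∂_{m} (∂_{m} f)) := by
    have := (hf.lineDerivOp (m := m)).lineDerivOp (m := m)
    norm_num at this
    exact this
  have hsum {ι : Type} (s : Finset ι) (m : ι → Config n p) :
      MemSobolev 0 2 (∑ i ∈ s, ∂_{m i} (∂_{m i} f)) := by
    classical
    induction s using Finset.induction_on with
    | empty => simp
    | insert a s ha ih => rw [Finset.sum_insert ha]; exact (key _).add ih
  exact memSobolev_zero_iff.1 (((hsum _ _).smul _).neg.sub (hsum _ _))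

/-- The domain `H² ∩ D(V)` of `-h² Δ_x - Δ_y + V`, where `D(V)` is the set of all `u` in `L²` with
`V u` in `L²`. -/
def hamiltonianDomain (n p : ℕ) (V : Config n p → ℝ) : Submodule ℂ (L2 n p) where
  carrier := {u | MemSobolev 2 2 (u : 𝓢'(Config n p, ℂ)) ∧
    MemLp (fun z => (V z : ℂ) * u z) 2 volume}
  zero_mem' := by
    refine ⟨?_, ?_⟩
    · rw [← Lp.toTemperedDistributionCLM_apply, map_zero]
      simp
    · refine (memLp_congr_ae ?_).2 (MemLp.zero (ε := ℂ))
      filter_upwards [Lp.coeFn_zero ℂ 2 (volume : Measure (Config n p))] with z hz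
      rw [hz, Pi.zero_apply, mul_zero]
  add_mem' := by
    rintro u v ⟨hu, hu'⟩ ⟨hv, hv'⟩
    refine ⟨?_, ?_⟩
    · rw [← Lp.toTemperedDistributionCLM_apply, map_add]
      exact hu.add hv
    · refine (memLp_congr_ae ?_).2 (hu'.add hv')
      filter_upwards [Lp.coeFn_add u v] with z hz
      simp only [Pi.add_apply] at hz ⊢
      rw [hz, mul_add]
  smul_mem' := by
    rintro c u ⟨hu, hu'⟩
    refine ⟨?_, ?_⟩
    · rw [← Lp.toTemperedDistributionCLM_apply, map_smul]
      exact hu.smul c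
    · refine (memLp_congr_ae ?_).2 (hu'.const_smul c)
      filter_upwards [Lp.coeFn_smul c u] with z hz
      simp [hz, mul_left_comm]

/-- The element of `L²` that represents the distribution `-h² Δ_x u - Δ_y u`, for `u` in `H²`. -/
def kineticL2 {n p : ℕ} (h : ℝ) {V : Config n p → ℝ} (u : hamiltonianDomain n p V) : L2 n p :=
  (exists_kinetic_eq h u.2.1).choose

theorem kineticL2_spec {n p : ℕ} (h : ℝ) {V : Config n p → ℝ} (u : hamiltonianDomain n p V) :
    kinetic h ((u : L2 n p) : 𝓢'(Config n p, ℂ)) = (kineticL2 h u : 𝓢'(Config n p, ℂ)) :=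
  (exists_kinetic_eq h u.2.1).choose_spec

theorem toTemperedDistribution_injective {n p : ℕ} {f g : L2 n p}
    (hfg : (f : 𝓢'(Config n p, ℂ)) = (g : 𝓢'(Config n p, ℂ))) : f = g :=
  LinearMap.ker_eq_bot.1
    (Lp.ker_toTemperedDistributionCLM_eq_bot (F := ℂ) (p := 2)
      (μ := (volume : Measure (Config n p)))) hfg

/-- The Hamiltonian `H(h) = -h² Δ_x - Δ_y + V` on `L²(ℝⁿ × ℝᵖ)` with domain `H² ∩ D(V)`. -/
def hamiltonian (n p : ℕ) (h : ℝ) (V : Config n p → ℝ) : L2 n p →ₗ.[ℂ] L2 n p where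
  domain := hamiltonianDomain n p V
  toFun :=
    { toFun := fun u => kineticL2 h u + u.2.2.toLp _
      map_add' := by
        intro u v
        have h1 : kineticL2 h (u + v) = kineticL2 h u + kineticL2 h v := by
          apply toTemperedDistribution_injective
          rw [← kineticL2_spec, ← Lp.toTemperedDistributionCLM_apply,
            ← Lp.toTemperedDistributionCLM_apply, map_add, Submodule.coe_add, map_add, kinetic_add]
          simp only [Lp.toTemperedDistributionCLM_apply, kineticL2_spec]
        have h2 : (u + v).2.2.toLp _ = u.2.2.toLp _ + v.2.2.toLp _ := by
          rw [← MemLp.toLp_add, MemLp.toLp_eq_toLp_iff]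
          filter_upwards [Lp.coeFn_add (u : L2 n p) v] with z hz
          simp only [Submodule.coe_add, Pi.add_apply] at hz ⊢
          rw [hz, mul_add]
        rw [h1, h2]
        abel
      map_smul' := by
        intro c u
        have h1 : kineticL2 h (c • u) = c • kineticL2 h u := by
          apply toTemperedDistribution_injective
          rw [← kineticL2_spec, ← Lp.toTemperedDistributionCLM_apply,
            ← Lp.toTemperedDistributionCLM_apply, map_smul, Submodule.coe_smul, map_smul,
            kinetic_smul]
          simp only [Lp.toTemperedDistributionCLM_apply, kineticL2_spec]
        have h2 : (c • u).2.2.toLp _ = c • u.2.2.toLp _ := by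
          rw [← MemLp.toLp_const_smul, MemLp.toLp_eq_toLp_iff]
          filter_upwards [Lp.coeFn_smul c (u : L2 n p)] with z hz
          simp [hz, mul_left_comm]
        rw [h1, h2, RingHom.id_apply, smul_add] }

/-- The potential `V(x, y) = ⟨A x, x⟩ + ⟨B y, y⟩`. -/
def harmonicPotential {n p : ℕ} (A : Matrix (Fin n) (Fin n) ℝ) (B : Matrix (Fin p) (Fin p) ℝ)
    (z : Config n p) : ℝ :=
  (A *ᵥ z.fst.ofLp) ⬝ᵥ z.fst.ofLp + (B *ᵥ z.snd.ofLp) ⬝ᵥ z.snd.ofLp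

end BornOppenheimer

end

/-! ### Operators that are diagonal in a Hilbert basis -/

namespace HilbertBasis

variable {I X : Type*} [NormedAddCommGroup X] [InnerProductSpace ℂ X]

/-! In orthonormal coordinates diagonalising `A` and `B`, the operator is a sum of one-dimensional
oscillators `-κ² ∂² + ω² x²`, with `κ = h` in the `x` directions and `κ = 1` in the `y` directions.
Applying the creation operators `ω x - κ ∂` to a Gaussian gives Schwartz eigenfunctions of energy `∑
(2 α k + 1) κ ω`. They are complete in `L²`, by a moment argument.

The delicate point is that `H² ∩ D(V)` is exactly the domain of the operator diagonal in this basis.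
One inclusion is duality: distributional derivatives move onto the Schwartz eigenfunctions, so the
coefficients of `H u` are those of `u` times the energies (`inner_hermiteBasis_hamiltonian`). For
the other (`mem_hamiltonian_domain`), `exists_norm_oscTerm_le` bounds each `-κ² ∂²` and each `ω² x²`
by the whole oscillator on Schwartz functions, and `exists_weak_oscTerm` passes to the limit along
Hermite expansions.

The spectrum is then read off (`opSpectrum_eq_range`, `opSpectrum_eq_discreteSpectrum`): only
finitely many energies lie below any bound, so off the energies the resolvent is an explicit bounded
diagonal operator. No self-adjointness theory enters. -/

theorem ext_inner (e : HilbertBasis I ℂ X) {u v : X}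
    (h : ∀ i, inner ℂ (e i) u = inner ℂ (e i) v) : u = v := by
  apply e.repr.injective
  ext i
  simpa [e.repr_apply_apply] using h i

/-- The bounded operator that multiplies the `i`-th coordinate by `c i`. -/
theorem exists_diagonal (e : HilbertBasis I ℂ X) (c : I → ℂ) {C : ℝ} (hC : ∀ i, ‖c i‖ ≤ C) :
    ∃ R : X →L[ℂ] X, ∀ v i, inner ℂ (e i) (R v) = c i * inner ℂ (e i) v := by
  let M := lp.mapCLM 2 (fun i => c i • ContinuousLinearMap.id ℂ ℂ) (abs_nonneg C) fun i => by
    rw [norm_smul, ContinuousLinearMap.norm_id, mul_one]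
    exact (hC i).trans (le_abs_self C)
  refine ⟨(e.repr.symm : lp (fun _ : I => ℂ) 2 →L[ℂ] X) ∘L M ∘L
    (e.repr : X →L[ℂ] lp (fun _ : I => ℂ) 2), fun v i => ?_⟩
  rw [← e.repr_apply_apply, ← e.repr_apply_apply]
  simp [M, lp.mapCLM]

/-- A vector with finitely many nonzero coordinates is a finite combination of basis vectors. -/
theorem eq_sum_of_inner_eq_zero (e : HilbertBasis I ℂ X) (F : Finset I) {u : X}
    (h : ∀ i ∉ F, inner ℂ (e i) u = 0) : u = ∑ i ∈ F, inner ℂ (e i) u • e i := by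
  classical
  refine e.ext_inner fun j => ?_
  simp only [inner_sum, inner_smul_right, orthonormal_iff_ite.1 e.orthonormal]
  by_cases hj : j ∈ F <;> simp [hj, h]

end HilbertBasis

namespace BornOppenheimer

section DiagonalOperator

variable {I X : Type*} [NormedAddCommGroup X] [InnerProductSpace ℂ X]
  {A : X →ₗ.[ℂ] X} {e : HilbertBasis I ℂ X} {c : I → ℝ}

/-- Only finitely many `c i` are at most `z.re + 1`, and all others are at distance at least one.
The gap serves both to bound the resolvent and to isolate spectral points. -/
theorem exists_gap (hfin : ∀ C, {i | c i ≤ C}.Finite) (z : ℂ) :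
    ∃ ε > (0 : ℝ), ∀ i, (c i : ℂ) ≠ z → ε ≤ ‖(c i : ℂ) - z‖ := by
  classical
  let F := (hfin (z.re + 1)).toFinset.filter fun i => (c i : ℂ) ≠ z
  obtain ⟨δ, hδ, h⟩ : ∃ δ > (0 : ℝ), ∀ i ∈ F, δ ≤ ‖(c i : ℂ) - z‖ := by
    by_cases hF : F.Nonempty
    · obtain ⟨j, hj, hmin⟩ := F.exists_min_image (fun i => ‖(c i : ℂ) - z‖) hF
      exact ⟨_, norm_pos_iff.2 (sub_ne_zero.2 (Finset.mem_filter.1 hj).2), hmin⟩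
    · exact ⟨1, one_pos, fun i hi => (hF ⟨i, hi⟩).elim⟩
  refine ⟨min δ 1, lt_min hδ one_pos, fun i hi => ?_⟩
  by_cases hiz : c i ≤ z.re + 1
  · exact (min_le_left _ _).trans (h i (by simp [F, hiz, hi]))
  · have : 1 ≤ ((c i : ℂ) - z).re := by
      simp only [Complex.sub_re, Complex.ofReal_re]
      linarith
    exact (min_le_right _ _).trans (this.trans (Complex.re_le_norm _))

-- Together these say that `A` is the maximal diagonal operator: it multiplies coordinates by `c`,
-- and its domain contains every `u` for which the products `c i * u i` are the coordinates of a
-- vector.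
variable (hcoef : ∀ (u : A.domain) i, inner ℂ (e i) (A u) = c i * inner ℂ (e i) (u : X))
  (hmem : ∀ u f : X, (∀ i, inner ℂ (e i) f = c i * inner ℂ (e i) u) → u ∈ A.domain)

include hcoef in
theorem inner_sub_smul (u : A.domain) (z : ℂ) (i : I) :
    inner ℂ (e i) (A u - z • (u : X)) = (c i - z) * inner ℂ (e i) (u : X) := by
  rw [inner_sub_right, inner_smul_right, hcoef, sub_mul]

include hcoef hmem

theorem isResolventPoint_of_notMem_range (hfin : ∀ C, {i | c i ≤ C}.Finite) {z : ℂ}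
    (hz : ∀ i, (c i : ℂ) ≠ z) : IsResolventPoint A z := by
  obtain ⟨ε, hε, hgap⟩ := exists_gap hfin z
  obtain ⟨R, hR⟩ := e.exists_diagonal (fun i => ((c i : ℂ) - z)⁻¹) (C := ε⁻¹) fun i => by
    rw [norm_inv]
    exact inv_anti₀ hε (hgap i (hz i))
  have hne (i : I) : (c i : ℂ) - z ≠ 0 := sub_ne_zero.2 (hz i)
  refine ⟨R, fun v => ?_, fun u => e.ext_inner fun i => ?_⟩
  -- Because `c / (c - z) = 1 + z / (c - z)`, the vector `v + z • R v` has the coordinates of `R v`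
  -- multiplied by `c`.
  · have hv : R v ∈ A.domain := hmem _ (v + z • R v) fun i => by
      rw [inner_add_right, inner_smul_right, hR]
      field_simp [hne i]
      ring
    refine ⟨hv, e.ext_inner fun i => ?_⟩
    rw [inner_sub_smul hcoef ⟨R v, hv⟩, hR, mul_inv_cancel_left₀ (hne i)]
  · rw [hR, inner_sub_smul hcoef, inv_mul_cancel_left₀ (hne i)]

theorem isEigenvalue_of_mem_range (i : I) : IsEigenvalue A (c i) := by
  classical
  have hi : e i ∈ A.domain := hmem _ ((c i : ℂ) • e i) fun j => by
    rw [inner_smul_right, orthonormal_iff_ite.1 e.orthonormal]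
    split_ifs with h <;> simp [h]
  refine ⟨⟨e i, hi⟩, fun h => e.orthonormal.ne_zero i (congrArg Subtype.val h),
    e.ext_inner fun j => ?_⟩
  rw [hcoef, inner_smul_right, orthonormal_iff_ite.1 e.orthonormal]
  split_ifs with h <;> simp [h]

omit hcoef hmem in
theorem mem_opSpectrum_of_isEigenvalue {z : ℂ} (hz : IsEigenvalue A z) : z ∈ opSpectrum A := by
  rintro ⟨R, -, hR⟩
  obtain ⟨u, hu, huz⟩ := hz
  have := hR u
  rw [huz, sub_self, map_zero] at this
  exact hu (Subtype.ext this.symm)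

omit hmem in
-- `A - z` multiplies this coordinate by the nonzero number `c i - z`, so no power of it can kill a
-- nonzero coordinate.
theorem inner_eq_zero_of_mem_genKernel {z : ℂ} {i : I} (hi : (c i : ℂ) ≠ z) (k : ℕ) :
    ∀ u ∈ genKernel A z k, inner ℂ (e i) u = 0 := by
  induction k with
  | zero => intro u hu; rw [(Submodule.mem_bot ℂ).1 hu, inner_zero_right]
  | succ k ih =>
    rintro _ ⟨u, hu, rfl⟩
    have h := ih _ hu
    have h' : (c i - z) * inner ℂ (e i) (u : X) = 0 := (inner_sub_smul hcoef u z i).symm.trans h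
    exact (mul_eq_zero.1 h').resolve_left (sub_ne_zero.2 hi)

omit hmem in
theorem finiteDimensional_rootSpace (hfin : ∀ C, {i | c i ≤ C}.Finite) (z : ℂ) :
    FiniteDimensional ℂ (rootSpace A z) := by
  classical
  have hF : {i | (c i : ℂ) = z}.Finite := (hfin z.re).subset fun i hi => by
    simp only [Set.mem_ofPred_eq] at hi ⊢
    simp [← hi]
  have hle : rootSpace A z ≤ Submodule.span ℂ (e '' {i | (c i : ℂ) = z}) := by
    refine iSup_le fun k u hu => ?_
    rw [e.eq_sum_of_inner_eq_zero hF.toFinset (u := u) fun i hi =>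
      inner_eq_zero_of_mem_genKernel hcoef (by simpa using hi) k u hu]
    exact Submodule.sum_mem _ fun i hi => Submodule.smul_mem _ _
      (Submodule.subset_span ⟨i, by simpa using hi, rfl⟩)
  have := FiniteDimensional.span_of_finite ℂ (hF.image e)
  exact Submodule.finiteDimensional_of_le hle

theorem opSpectrum_eq_range (hfin : ∀ C, {i | c i ≤ C}.Finite) :
    opSpectrum A = {z | ∃ i, (c i : ℂ) = z} := by
  ext z
  constructor
  · intro hz
    by_contra h
    exact hz (isResolventPoint_of_notMem_range hcoef hmem hfin fun i hi => h ⟨i, hi⟩)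
  · rintro ⟨i, rfl⟩
    exact mem_opSpectrum_of_isEigenvalue (isEigenvalue_of_mem_range hcoef hmem i)

theorem opSpectrum_eq_discreteSpectrum (hfin : ∀ C, {i | c i ≤ C}.Finite) :
    opSpectrum A = discreteSpectrum A := by
  refine Set.Subset.antisymm (fun z hz => ?_) fun z hz => hz.1
  have hs := opSpectrum_eq_range hcoef hmem hfin
  obtain ⟨i, rfl⟩ := hs ▸ hz
  obtain ⟨ε, hε, hgap⟩ := exists_gap hfin (c i : ℂ)
  refine ⟨hz, isEigenvalue_of_mem_range hcoef hmem i, finiteDimensional_rootSpace hcoef hfin _,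
    ε, hε, fun z' hz' hd => ?_⟩
  obtain ⟨j, rfl⟩ := hs ▸ hz'
  by_contra hne
  rw [dist_eq_norm] at hd
  exact (hgap j hne).not_gt hd

end DiagonalOperator

end BornOppenheimer

noncomputable section

/-! ### Position and derivative operators on Schwartz space -/

namespace BornOppenheimer

variable {E : Type*} [NormedAddCommGroup E] [InnerProductSpace ℝ E]

/-- Multiplication by the linear form `⟨m, ·⟩`. -/
def coordMul (m : E) : 𝓢(E, ℂ) →L[ℂ] 𝓢(E, ℂ) :=
  SchwartzMap.smulLeftCLM ℂ fun x => ((inner ℝ m x : ℝ) : ℂ)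

/-- The derivative in the direction `m`. -/
def dirDeriv (m : E) : 𝓢(E, ℂ) →L[ℂ] 𝓢(E, ℂ) := LineDeriv.lineDerivOpCLM ℂ 𝓢(E, ℂ) m

/-- Complex conjugation of Schwartz functions. -/
def conjS (f : 𝓢(E, ℂ)) : 𝓢(E, ℂ) :=
  SchwartzMap.postcompCLM (𝕜 := ℝ) (Complex.conjCLE : ℂ →L[ℝ] ℂ) f

@[simp]
theorem conjS_apply (f : 𝓢(E, ℂ)) (x : E) : conjS f x = starRingEnd ℂ (f x) := rfl

@[simp]
theorem conjS_conjS (f : 𝓢(E, ℂ)) : conjS (conjS f) = f := by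
  ext x
  simp

@[simp]
theorem coordMul_apply (m : E) (f : 𝓢(E, ℂ)) (x : E) :
    coordMul m f x = ((inner ℝ m x : ℝ) : ℂ) * f x := by
  rw [coordMul, SchwartzMap.smulLeftCLM_apply_apply (by fun_prop), smul_eq_mul]

theorem dirDeriv_eq (m : E) (f : 𝓢(E, ℂ)) : dirDeriv m f = ∂_{m} f := rfl

theorem dirDeriv_apply (m : E) (f : 𝓢(E, ℂ)) (x : E) :
    dirDeriv m f x = fderiv ℝ f x m := rfl

theorem coordMul_comm (l m : E) (f : 𝓢(E, ℂ)) :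
    coordMul l (coordMul m f) = coordMul m (coordMul l f) := by
  ext x
  simp only [coordMul_apply]
  ring

theorem dirDeriv_comm (l m : E) (f : 𝓢(E, ℂ)) :
    dirDeriv l (dirDeriv m f) = dirDeriv m (dirDeriv l f) := by
  ext x
  have hd : DifferentiableAt ℝ (fderiv ℝ f) x :=
    ((f.smooth 2).fderiv_right (m := 1) (by norm_num)).differentiable (by norm_num) x
  have key (l m : E) : dirDeriv l (dirDeriv m f) x = fderiv ℝ (fderiv ℝ f) x l m := by
    rw [dirDeriv_apply]
    have : (dirDeriv m f : E → ℂ) = fun y => fderiv ℝ f y m := rfl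
    rw [this, fderiv_clm_apply hd (differentiableAt_const m)]
    simp
  rw [key, key]
  exact ((f.smooth 2).contDiffAt.isSymmSndFDerivAt (by simp)).eq l m

/-- The Leibniz rule, in the form of the canonical commutation relation on which all ladder
identities and the separation estimate rest. -/
theorem dirDeriv_coordMul (l m : E) (f : 𝓢(E, ℂ)) :
    dirDeriv m (coordMul l f) = coordMul l (dirDeriv m f) + ((inner ℝ l m : ℝ) : ℂ) • f := by
  ext x
  have h1 : HasFDerivAt (fun y : E => ((inner ℝ l y : ℝ) : ℂ))
      (Complex.ofRealCLM ∘L innerSL ℝ l) x :=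
    (Complex.ofRealCLM ∘L innerSL ℝ l).hasFDerivAt
  have h2 := h1.mul (f.hasFDerivAt x)
  have : (coordMul l f : E → ℂ) = fun y => ((inner ℝ l y : ℝ) : ℂ) * f y := by
    ext y; simp
  rw [dirDeriv_apply, this]
  erw [h2.fderiv]
  simp [dirDeriv_apply, mul_comm]

theorem dirDeriv_conjS (m : E) (f : 𝓢(E, ℂ)) : dirDeriv m (conjS f) = conjS (dirDeriv m f) := by
  ext x
  have h := (Complex.conjCLE : ℂ →L[ℝ] ℂ).hasFDerivAt.comp x (f.hasFDerivAt x)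
  rw [dirDeriv_apply, conjS_apply, dirDeriv_apply]
  exact congrArg (fun L => L m) h.fderiv

theorem dirDeriv_smul_left (r : ℝ) (m : E) (f : 𝓢(E, ℂ)) :
    dirDeriv (r • m) f = (r : ℂ) • dirDeriv m f := by
  ext x
  simp [dirDeriv_apply]

theorem coordMul_smul_left (r : ℝ) (m : E) (f : 𝓢(E, ℂ)) :
    coordMul (r • m) f = (r : ℂ) • coordMul m f := by
  ext x
  simp [inner_smul_left, mul_assoc]

/-! ### `L²` pairings of Schwartz functions -/

section Inner

variable [FiniteDimensional ℝ E] [MeasurableSpace E] [BorelSpace E]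

/-- The embedding of Schwartz space into `L²`. -/
def toL2 : 𝓢(E, ℂ) →L[ℂ] Lp ℂ 2 (volume : Measure E) := SchwartzMap.toLpCLM ℂ ℂ 2 volume

theorem coeFn_toL2 (f : 𝓢(E, ℂ)) : toL2 f =ᵐ[volume] f := f.coeFn_toLp 2 volume

theorem toL2_injective : Function.Injective (toL2 : 𝓢(E, ℂ) → Lp ℂ 2 (volume : Measure E)) :=
  SchwartzMap.injective_toLp 2 volume

theorem inner_toL2 (f g : 𝓢(E, ℂ)) :
    inner ℂ (toL2 f) (toL2 g) = ∫ x, starRingEnd ℂ (f x) * g x := by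
  refine (SchwartzMap.inner_toL2_toL2_eq f g volume).trans ?_
  simp only [RCLike.inner_apply, mul_comm]

/-- The `L²` inner product with a Schwartz function as a distributional pairing. -/
theorem inner_toL2_left (f : 𝓢(E, ℂ)) (u : Lp ℂ 2 (volume : Measure E)) :
    inner ℂ (toL2 f) u = (u : 𝓢'(E, ℂ)) (conjS f) := by
  rw [L2.inner_def, Lp.toTemperedDistribution_apply]
  refine integral_congr_ae ?_
  filter_upwards [coeFn_toL2 f] with x hx
  rw [hx, RCLike.inner_apply, conjS_apply, smul_eq_mul, mul_comm]

theorem inner_dirDeriv (m : E) (f g : 𝓢(E, ℂ)) :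
    inner ℂ (toL2 (dirDeriv m f)) (toL2 g) = -inner ℂ (toL2 f) (toL2 (dirDeriv m g)) := by
  rw [inner_toL2, inner_toL2]
  have h := SchwartzMap.integral_mul_lineDerivOp_right_eq_neg_left (μ := volume) (conjS f) g m
  simp only [← dirDeriv_eq, dirDeriv_conjS, conjS_apply] at h
  rw [h, neg_neg]

theorem inner_coordMul (m : E) (f g : 𝓢(E, ℂ)) :
    inner ℂ (toL2 (coordMul m f)) (toL2 g) = inner ℂ (toL2 f) (toL2 (coordMul m g)) := by
  rw [inner_toL2, inner_toL2]
  refine integral_congr_ae (.of_forall fun x => ?_)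
  simp only [coordMul_apply, map_mul, Complex.conj_ofReal]
  ring

end Inner

end BornOppenheimer
end

noncomputable section

/-! ### The separation estimate -/

namespace BornOppenheimer

/-- Expand the squared norm of the sum into `card κ ^ 2` inner products. After adding `d` to each,
all are nonnegative, so the diagonal one at `r` is at most the total. -/
theorem norm_sq_le_norm_sq_sum_add {κ X : Type*} [Fintype κ] [NormedAddCommGroup X]
    [InnerProductSpace ℂ X] (x : κ → X) {d : ℝ} (hd : 0 ≤ d)
    (h : ∀ s t, -d ≤ (inner ℂ (x s) (x t)).re) (r : κ) :
    ‖x r‖ ^ 2 ≤ ‖∑ s, x s‖ ^ 2 + Fintype.card κ ^ 2 * d := by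
  have hsum : ‖∑ s, x s‖ ^ 2 + Fintype.card κ ^ 2 * d =
      ∑ s, ∑ t, ((inner ℂ (x s) (x t)).re + d) := by
    rw [← inner_self_eq_norm_sq (𝕜 := ℂ), RCLike.re_eq_complex_re]
    simp only [sum_inner, inner_sum, Complex.re_sum, Finset.sum_add_distrib, Finset.sum_const,
      Finset.card_univ, nsmul_eq_mul]
    rw [Finset.sum_comm]
    ring
  have hnn (s t : κ) : 0 ≤ (inner ℂ (x s) (x t)).re + d := by linarith [h s t]
  rw [hsum]
  calc ‖x r‖ ^ 2 ≤ (inner ℂ (x r) (x r)).re + d := by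
        rw [← inner_self_eq_norm_sq (𝕜 := ℂ), RCLike.re_eq_complex_re]
        linarith
    _ ≤ ∑ t, ((inner ℂ (x r) (x t)).re + d) :=
        Finset.single_le_sum (f := fun t => (inner ℂ (x r) (x t)).re + d)
          (fun t _ => hnn r t) (Finset.mem_univ r)
    _ ≤ _ := Finset.single_le_sum (f := fun s => ∑ t, ((inner ℂ (x s) (x t)).re + d))
          (fun s _ => Finset.sum_nonneg fun t _ => hnn s t) (Finset.mem_univ r)

variable {E ι : Type*} [NormedAddCommGroup E] [InnerProductSpace ℝ E]

/-- The summands `-∂_{m k}²` and `⟨l k, ·⟩²` of the oscillator. -/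
def oscTerm (m l : ι → E) : ι ⊕ ι → 𝓢(E, ℂ) →L[ℂ] 𝓢(E, ℂ)
  | .inl k => -(dirDeriv (m k) ∘L dirDeriv (m k))
  | .inr k => coordMul (l k) ∘L coordMul (l k)

theorem oscTerm_inl (m l : ι → E) (k : ι) (u : 𝓢(E, ℂ)) :
    oscTerm m l (.inl k) u = -dirDeriv (m k) (dirDeriv (m k) u) := rfl

theorem oscTerm_inr (m l : ι → E) (k : ι) (u : 𝓢(E, ℂ)) :
    oscTerm m l (.inr k) u = coordMul (l k) (coordMul (l k) u) := rfl

/-- The oscillator `∑ k, (-∂_{m k}² + ⟨l k, ·⟩²)` on Schwartz space. -/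
def osc [Fintype ι] (m l : ι → E) : 𝓢(E, ℂ) →L[ℂ] 𝓢(E, ℂ) := ∑ s, oscTerm m l s

theorem osc_apply [Fintype ι] (m l : ι → E) (u : 𝓢(E, ℂ)) :
    osc m l u = ∑ s, oscTerm m l s u := by
  simp [osc]

theorem osc_apply' [Fintype ι] (m l : ι → E) (u : 𝓢(E, ℂ)) :
    osc m l u = ∑ k, (-dirDeriv (m k) (dirDeriv (m k) u) + coordMul (l k) (coordMul (l k) u)) := by
  rw [osc_apply, Fintype.sum_sum_type, Finset.sum_add_distrib]
  rfl

variable [FiniteDimensional ℝ E] [MeasurableSpace E] [BorelSpace E]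

theorem re_inner_self_nonneg (u : 𝓢(E, ℂ)) : 0 ≤ (inner ℂ (toL2 u) (toL2 u)).re :=
  inner_self_nonneg (𝕜 := ℂ)

/-- Integration by parts turns the inner product into minus its conjugate, up to the commutator. -/
theorem re_inner_dirDeriv_coordMul (m l : E) (u : 𝓢(E, ℂ)) :
    2 * (inner ℂ (toL2 (dirDeriv m u)) (toL2 (coordMul l u))).re =
      -(inner ℝ l m * ‖toL2 u‖ ^ 2) := by
  have h1 : inner ℂ (toL2 (dirDeriv m u)) (toL2 (coordMul l u)) =
      -inner ℂ (toL2 (coordMul l u)) (toL2 (dirDeriv m u)) -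
        ((inner ℝ l m : ℝ) : ℂ) * inner ℂ (toL2 u) (toL2 u) := by
    rw [inner_dirDeriv, dirDeriv_coordMul, map_add, inner_add_right, map_smul, inner_smul_right,
      ← inner_coordMul]
    ring
  have h2 : (inner ℂ (toL2 (coordMul l u)) (toL2 (dirDeriv m u))).re =
      (inner ℂ (toL2 (dirDeriv m u)) (toL2 (coordMul l u))).re :=
    inner_re_symm (𝕜 := ℂ) _ _
  have h3 := congrArg Complex.re h1
  rw [Complex.sub_re, Complex.neg_re, Complex.re_ofReal_mul, h2] at h3
  have h4 : (inner ℂ (toL2 u) (toL2 u)).re = ‖toL2 u‖ ^ 2 := inner_self_eq_norm_sq (𝕜 := ℂ) _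
  rw [h4] at h3
  linarith

/-- Moving one derivative and one factor across leaves the square norm of `⟨l, ·⟩ ∂_m u` plus a
commutator term whose real part is exactly the left side. -/
theorem re_inner_neg_dirDeriv_sq_coordMul_sq (m l : E) (u : 𝓢(E, ℂ)) :
    -((inner ℝ l m) ^ 2 * ‖toL2 u‖ ^ 2) ≤ (inner ℂ (toL2 (-dirDeriv m (dirDeriv m u)))
      (toL2 (coordMul l (coordMul l u)))).re := by
  have h1 : inner ℂ (toL2 (-dirDeriv m (dirDeriv m u))) (toL2 (coordMul l (coordMul l u))) =
      inner ℂ (toL2 (coordMul l (dirDeriv m u))) (toL2 (coordMul l (dirDeriv m u))) +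
        ((2 * inner ℝ l m : ℝ) : ℂ) * inner ℂ (toL2 (dirDeriv m u)) (toL2 (coordMul l u)) := by
    rw [map_neg, inner_neg_left, inner_dirDeriv, neg_neg, dirDeriv_coordMul, dirDeriv_coordMul,
      inner_coordMul]
    simp only [map_add, map_smul, inner_add_right, inner_smul_right]
    push_cast
    ring
  have h2 := re_inner_dirDeriv_coordMul m l u
  have h3 := re_inner_self_nonneg (coordMul l (dirDeriv m u))
  rw [h1, Complex.add_re, Complex.re_ofReal_mul]
  linear_combination h3 - (inner ℝ l m) * h2

/-- Two summands of the same kind commute, and their pairing is a squared norm; only mixed pairs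
cost a commutator. The double sum is a bound common to all pairs. -/
theorem neg_le_re_inner_oscTerm [Fintype ι] (m l : ι → E) (u : 𝓢(E, ℂ)) (s t : ι ⊕ ι) :
    -((∑ j, ∑ k, (inner ℝ (l k) (m j)) ^ 2) * ‖toL2 u‖ ^ 2) ≤
      (inner ℂ (toL2 (oscTerm m l s u)) (toL2 (oscTerm m l t u))).re := by
  have hd : 0 ≤ (∑ j, ∑ k, (inner ℝ (l k) (m j)) ^ 2) * ‖toL2 u‖ ^ 2 :=
    mul_nonneg (Finset.sum_nonneg fun _ _ => Finset.sum_nonneg fun _ _ => sq_nonneg _)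
      (sq_nonneg _)
  have hle (j k : ι) : -((∑ j, ∑ k, (inner ℝ (l k) (m j)) ^ 2) * ‖toL2 u‖ ^ 2) ≤
      -((inner ℝ (l k) (m j)) ^ 2 * ‖toL2 u‖ ^ 2) := by
    refine neg_le_neg (mul_le_mul_of_nonneg_right ?_ (sq_nonneg _))
    exact (Finset.single_le_sum (f := fun k => (inner ℝ (l k) (m j)) ^ 2)
      (fun _ _ => sq_nonneg _) (Finset.mem_univ k)).trans
      (Finset.single_le_sum (f := fun j => ∑ k, (inner ℝ (l k) (m j)) ^ 2)
        (fun _ _ => Finset.sum_nonneg fun _ _ => sq_nonneg _) (Finset.mem_univ j))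
  rcases s with j | j <;> rcases t with k | k
  · have : inner ℂ (toL2 (oscTerm m l (.inl j) u)) (toL2 (oscTerm m l (.inl k) u)) =
        inner ℂ (toL2 (dirDeriv (m k) (dirDeriv (m j) u)))
          (toL2 (dirDeriv (m k) (dirDeriv (m j) u))) := by
      rw [oscTerm_inl, oscTerm_inl, map_neg, map_neg, inner_neg_neg, inner_dirDeriv,
        dirDeriv_comm (m j) (m k) (dirDeriv (m k) u), ← inner_dirDeriv,
        dirDeriv_comm (m j) (m k) u]
    rw [this]
    linarith [re_inner_self_nonneg (dirDeriv (m k) (dirDeriv (m j) u))]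
  · exact (hle j k).trans (re_inner_neg_dirDeriv_sq_coordMul_sq (m j) (l k) u)
  · refine ((hle k j).trans (re_inner_neg_dirDeriv_sq_coordMul_sq (m k) (l j) u)).trans_eq ?_
    exact inner_re_symm (𝕜 := ℂ) _ _
  · have : inner ℂ (toL2 (oscTerm m l (.inr j) u)) (toL2 (oscTerm m l (.inr k) u)) =
        inner ℂ (toL2 (coordMul (l k) (coordMul (l j) u)))
          (toL2 (coordMul (l k) (coordMul (l j) u))) := by
      rw [oscTerm_inr, oscTerm_inr, inner_coordMul, coordMul_comm (l j) (l k), inner_coordMul (l k),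
        coordMul_comm (l j) (l k), ← inner_coordMul (l k), coordMul_comm (l k) (l j)]
    rw [this]
    linarith [re_inner_self_nonneg (coordMul (l k) (coordMul (l j) u))]

/-- Each summand of the oscillator is bounded relative to the oscillator. -/
theorem exists_norm_oscTerm_le [Fintype ι] (m l : ι → E) :
    ∃ C, 0 ≤ C ∧ ∀ (u : 𝓢(E, ℂ)) (s : ι ⊕ ι),
      ‖toL2 (oscTerm m l s u)‖ ≤ ‖toL2 (osc m l u)‖ + C * ‖toL2 u‖ := by
  set d := ∑ j, ∑ k, (inner ℝ (l k) (m j)) ^ 2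
  have hd : 0 ≤ d := Finset.sum_nonneg fun _ _ => Finset.sum_nonneg fun _ _ => sq_nonneg _
  -- The constant is the square root of the factor `card ^ 2 * d` in the squared estimate; then `a²
  -- + b² ≤ (a + b)²`.
  refine ⟨Fintype.card (ι ⊕ ι) * √d, by positivity, fun u s => ?_⟩
  have h := norm_sq_le_norm_sq_sum_add (fun s => toL2 (oscTerm m l s u))
    (mul_nonneg hd (sq_nonneg ‖toL2 u‖)) (neg_le_re_inner_oscTerm m l u) s
  rw [← map_sum, ← osc_apply] at h
  refine abs_le_of_sq_le_sq' ?_ (by positivity) |>.2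
  have h2 : (Fintype.card (ι ⊕ ι) * √d * ‖toL2 u‖) ^ 2 =
      Fintype.card (ι ⊕ ι) ^ 2 * (d * ‖toL2 u‖ ^ 2) := by
    rw [mul_pow, mul_pow, Real.sq_sqrt hd]
    ring
  have h3 : 0 ≤ ‖toL2 (osc m l u)‖ * (Fintype.card (ι ⊕ ι) * √d * ‖toL2 u‖) := by positivity
  rw [add_sq, h2]
  linarith

end BornOppenheimer
end

noncomputable section

/-! ### Gaussians as Schwartz functions -/

namespace BornOppenheimer

/-- Use `t ^ N ≤ N! exp t` at `t = 1 + r`, then complete the square in `r - a r²`. -/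
theorem one_add_pow_mul_exp_le {a : ℝ} (ha : 0 < a) (N : ℕ) {r : ℝ} (hr : 0 ≤ r) :
    (1 + r) ^ N * Real.exp (-(a * r ^ 2)) ≤ N.factorial * Real.exp (1 + 1 / (4 * a)) := by
  have h1 : (1 + r) ^ N ≤ N.factorial * Real.exp (1 + r) := by
    have := Real.pow_div_factorial_le_exp (1 + r) (by positivity) N
    rwa [div_le_iff₀ (by positivity), mul_comm] at this
  calc (1 + r) ^ N * Real.exp (-(a * r ^ 2))
      ≤ N.factorial * Real.exp (1 + r) * Real.exp (-(a * r ^ 2)) := by gcongr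
    _ = N.factorial * Real.exp (1 + r - a * r ^ 2) := by
        rw [mul_assoc, ← Real.exp_add, sub_eq_add_neg]
    _ ≤ _ := by
        gcongr
        rw [add_sub_assoc]
        gcongr
        have : 1 / (4 * a) - (r - a * r ^ 2) = (2 * a * r - 1) ^ 2 / (4 * a) := by
          field_simp
          ring
        have h2 : 0 ≤ (2 * a * r - 1) ^ 2 / (4 * a) := by positivity
        linarith

variable {E : Type*} [NormedAddCommGroup E] [InnerProductSpace ℝ E]

/-- The Faà di Bruno bound: derivatives of `exp` reproduce it, while those of `f` grow polynomially.
-/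
theorem norm_iteratedFDeriv_exp_comp_le {f : E → ℝ} (hf : f.HasTemperateGrowth) (n : ℕ) :
    ∃ (N : ℕ) (C : ℝ), 0 ≤ C ∧ ∀ x,
      ‖iteratedFDeriv ℝ n (fun x => Real.exp (f x)) x‖ ≤ C * (1 + ‖x‖) ^ N * Real.exp (f x) := by
  obtain ⟨k, C, hC, h⟩ := hf.norm_iteratedFDeriv_le_uniform n
  refine ⟨k * n, n.factorial * (1 + C) ^ n, by positivity, fun x => ?_⟩
  -- Enlarging `C` by one makes the base at least one, so it is dominated by its positive powers.
  have hD : 1 ≤ (1 + C) * (1 + ‖x‖) ^ k := by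
    have : 1 ≤ (1 + ‖x‖) ^ k := one_le_pow₀ (by simp)
    nlinarith
  have := norm_iteratedFDeriv_comp_le (g := Real.exp) (f := f) (n := n)
    (N := ((⊤ : ℕ∞) : WithTop ℕ∞))
    (C := Real.exp (f x)) (D := (1 + C) * (1 + ‖x‖) ^ k) Real.contDiff_exp hf.1
    (mod_cast le_top) x
    (fun i _ => by
      rw [norm_iteratedFDeriv_eq_norm_iteratedDeriv, iteratedDeriv_eq_iterate, Real.iter_deriv_exp,
        Real.norm_of_nonneg (Real.exp_pos _).le])
    (fun i hi hin => by
      calc ‖iteratedFDeriv ℝ i f x‖ ≤ C * (1 + ‖x‖) ^ k := h i hin x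
        _ ≤ (1 + C) * (1 + ‖x‖) ^ k := by gcongr; linarith
        _ ≤ _ := le_self_pow₀ hD (by omega))
  refine this.trans_eq ?_
  rw [mul_pow, pow_mul]
  ring

/-- The exponential of a function of temperate growth that tends to `-∞` quadratically is a Schwartz
function. -/
theorem exists_schwartz_exp {f : E → ℝ} (hf : f.HasTemperateGrowth) {a C : ℝ} (ha : 0 < a)
    (hle : ∀ x, f x ≤ C - a * ‖x‖ ^ 2) :
    ∃ g : 𝓢(E, ℂ), ∀ x, g x = (Real.exp (f x) : ℂ) := by
  have hsmooth : ContDiff ℝ ((⊤ : ℕ∞) : WithTop ℕ∞) fun x => Real.exp (f x) :=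
    Real.contDiff_exp.comp hf.1
  refine ⟨⟨fun x => (Real.exp (f x) : ℂ), Complex.ofRealCLM.contDiff.comp hsmooth,
    fun k n => ?_⟩, fun x => rfl⟩
  obtain ⟨N, B, hB, h⟩ := norm_iteratedFDeriv_exp_comp_le hf n
  refine ⟨B * Real.exp C * ((k + N).factorial * Real.exp (1 + 1 / (4 * a))), fun x => ?_⟩
  have h1 : ‖iteratedFDeriv ℝ n (fun x => (Real.exp (f x) : ℂ)) x‖ =
      ‖iteratedFDeriv ℝ n (fun x => Real.exp (f x)) x‖ :=
    Complex.ofRealLI.norm_iteratedFDeriv_comp_left (hsmooth.contDiffAt.of_le le_rfl)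
      (mod_cast le_top)
  rw [h1]
  calc ‖x‖ ^ k * ‖iteratedFDeriv ℝ n (fun x => Real.exp (f x)) x‖
      ≤ (1 + ‖x‖) ^ k * (B * (1 + ‖x‖) ^ N * Real.exp (C - a * ‖x‖ ^ 2)) := by
        gcongr
        · linarith [norm_nonneg x]
        · refine (h x).trans ?_
          gcongr
          exact hle x
    _ = B * Real.exp C * ((1 + ‖x‖) ^ (k + N) * Real.exp (-(a * ‖x‖ ^ 2))) := by
        rw [sub_eq_add_neg, Real.exp_add, pow_add]
        ring
    _ ≤ _ := by
        exact mul_le_mul_of_nonneg_left (one_add_pow_mul_exp_le ha _ (norm_nonneg x))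
          (by positivity)

variable {ι : Type*} [Fintype ι]

/-- The case `v = 0` gives the ground state; general `v` supplies the exponential weights in the
completeness proof. -/
theorem exists_gaussian_mul_exp (b : OrthonormalBasis ι ℝ E) {c : ι → ℝ} (hc : ∀ k, 0 < c k)
    (v : E) : ∃ g : 𝓢(E, ℂ), ∀ x,
      g x = (Real.exp (inner ℝ v x - (∑ k, c k * inner ℝ (b k) x ^ 2) / 2) : ℂ) := by
  obtain ⟨a, ha, hac⟩ : ∃ a > 0, ∀ k, a ≤ c k := by
    cases isEmpty_or_nonempty ι
    · exact ⟨1, one_pos, fun k => isEmptyElim k⟩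
    · obtain ⟨j, hj⟩ := Finite.exists_min c
      exact ⟨c j, hc j, hj⟩
  -- Half of the decay `a ‖x‖² / 2` absorbs `‖v‖ ‖x‖`; the defect is the square `(2‖v‖ - a‖x‖)² /
  -- (4a)`.
  refine exists_schwartz_exp (a := a / 4) (C := ‖v‖ ^ 2 / a) ?_ (by positivity) fun x => ?_
  · have h1 : (fun x => inner ℝ v x).HasTemperateGrowth := by fun_prop
    have h2 : (fun x => (1 / 2 : ℝ) * ∑ k, c k * inner ℝ (b k) x ^ 2).HasTemperateGrowth := by
      refine (Function.HasTemperateGrowth.const _).mul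
        (Function.HasTemperateGrowth.sum fun k _ => ?_)
      fun_prop
    convert h1.sub h2 using 1
    ext x
    simp only [Pi.sub_apply]
    ring
  · have h1 : a * ‖x‖ ^ 2 ≤ ∑ k, c k * inner ℝ (b k) x ^ 2 := by
      have : ‖x‖ ^ 2 = ∑ k, inner ℝ (b k) x ^ 2 := by
        rw [← b.sum_sq_norm_inner_right x]
        simp
      rw [this, Finset.mul_sum]
      exact Finset.sum_le_sum fun k _ => mul_le_mul_of_nonneg_right (hac k) (sq_nonneg _)
    have h2 := real_inner_le_norm v x
    have h3 : ‖v‖ ^ 2 / a - a / 4 * ‖x‖ ^ 2 - (‖v‖ * ‖x‖ - a * ‖x‖ ^ 2 / 2) =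
        (2 * ‖v‖ - a * ‖x‖) ^ 2 / (4 * a) := by
      field_simp
      ring
    have h4 : 0 ≤ (2 * ‖v‖ - a * ‖x‖) ^ 2 / (4 * a) := by positivity
    linarith

/-- The Gaussian `exp (-∑ k, c k * ⟨b k, x⟩² / 2)`. -/
def gaussian (b : OrthonormalBasis ι ℝ E) {c : ι → ℝ} (hc : ∀ k, 0 < c k) : 𝓢(E, ℂ) :=
  (exists_gaussian_mul_exp b hc 0).choose

theorem gaussian_apply (b : OrthonormalBasis ι ℝ E) {c : ι → ℝ} (hc : ∀ k, 0 < c k) (x : E) :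
    gaussian b hc x = (Real.exp (-(∑ k, c k * inner ℝ (b k) x ^ 2) / 2) : ℂ) := by
  rw [gaussian, (exists_gaussian_mul_exp b hc 0).choose_spec, inner_zero_left, zero_sub, neg_div]

theorem dirDeriv_gaussian (b : OrthonormalBasis ι ℝ E) {c : ι → ℝ} (hc : ∀ k, 0 < c k) (k : ι) :
    dirDeriv (b k) (gaussian b hc) = -((c k : ℂ) • coordMul (b k) (gaussian b hc)) := by
  classical
  ext x
  have h1 : HasFDerivAt (fun x : E => -(∑ j, c j * inner ℝ (b j) x ^ 2) / 2)
      (-(∑ j, (c j * inner ℝ (b j) x) • innerSL ℝ (b j))) x := by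
    have h (j : ι) : HasFDerivAt (fun x : E => c j * inner ℝ (b j) x ^ 2)
        (c j • (2 * inner ℝ (b j) x) • innerSL ℝ (b j)) x := by
      have := (((innerSL ℝ (b j)).hasFDerivAt (x := x)).pow 2).const_mul (c j)
      simpa using this
    have h2 := (HasFDerivAt.fun_sum (u := Finset.univ) fun j _ => h j).const_mul (-1 / 2)
    refine (h2.congr_fderiv ?_).congr_of_eventuallyEq (.of_forall fun y => ?_)
    · rw [Finset.smul_sum, ← Finset.sum_neg_distrib]
      refine Finset.sum_congr rfl fun j _ => ?_
      rw [smul_smul, smul_smul, ← neg_smul]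
      congr 1
      ring
    · simp only
      ring
  have h2 := Complex.ofRealCLM.hasFDerivAt.comp x h1.exp
  have h3 : (gaussian b hc : E → ℂ) =
      Complex.ofRealCLM ∘ fun x => Real.exp (-(∑ j, c j * inner ℝ (b j) x ^ 2) / 2) := by
    ext y
    rw [gaussian_apply]
    rfl
  rw [dirDeriv_apply, h3, h2.fderiv]
  simp [gaussian_apply, b.inner_eq_ite, mul_comm, mul_assoc]

end BornOppenheimer
end

noncomputable section

/-! ### Ladder operators and Hermite functions -/

namespace BornOppenheimer

/-- Induction on the total degree: a nonzero multi-index dominates some unit vector. -/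
theorem pi_nat_induction {ι : Type*} [Fintype ι] [DecidableEq ι] {P : (ι → ℕ) → Prop} (h0 : P 0)
    (hadd : ∀ α k, P α → P (α + Pi.single k 1)) (α : ι → ℕ) : P α := by
  induction hn : ∑ k, α k generalizing α with
  | zero =>
    have : α = 0 := funext fun k => (Finset.sum_eq_zero_iff.1 hn) k (Finset.mem_univ k)
    exact this ▸ h0
  | succ n ih =>
    obtain ⟨k, hk⟩ : ∃ k, α k ≠ 0 := by
      by_contra! h
      simp [h] at hn
    obtain ⟨β, rfl⟩ : ∃ β, α = β + Pi.single k 1 := by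
      refine ⟨α - Pi.single k 1, (tsub_add_cancel_of_le ?_).symm⟩
      intro j
      by_cases hj : j = k
      · subst hj
        simpa using Nat.one_le_iff_ne_zero.2 hk
      · simp [hj]
    refine hadd β k (ih β ?_)
    simp only [Pi.add_apply, Finset.sum_add_distrib, Finset.sum_pi_single', Finset.mem_univ,
      if_true] at hn
    simpa using hn

/-- Orthonormal directions with the coefficients of the derivatives and of the potential. -/
structure OscillatorData (ι E : Type*) [Fintype ι] [NormedAddCommGroup E]
    [InnerProductSpace ℝ E] where
  /-- the normal directions -/
  basis : OrthonormalBasis ι ℝ E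
  /-- the coefficient of the derivative -/
  kin : ι → ℝ
  /-- the frequency of the potential -/
  freq : ι → ℝ
  kin_pos : ∀ k, 0 < kin k
  freq_pos : ∀ k, 0 < freq k

namespace OscillatorData

variable {ι E : Type*} [Fintype ι] [NormedAddCommGroup E] [InnerProductSpace ℝ E]
  (O : OscillatorData ι E)

/-- The direction of differentiation, scaled. -/
def kinVec (k : ι) : E := O.kin k • O.basis k

/-- The linear form of the potential. -/
def potVec (k : ι) : E := O.freq k • O.basis k

/-- The creation operator. -/
def raise (k : ι) : 𝓢(E, ℂ) →L[ℂ] 𝓢(E, ℂ) := coordMul (O.potVec k) - dirDeriv (O.kinVec k)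

/-- The annihilation operator. -/
def lower (k : ι) : 𝓢(E, ℂ) →L[ℂ] 𝓢(E, ℂ) := coordMul (O.potVec k) + dirDeriv (O.kinVec k)

/-- The oscillator on Schwartz space. -/
def ham : 𝓢(E, ℂ) →L[ℂ] 𝓢(E, ℂ) := osc O.kinVec O.potVec

theorem raise_apply (k : ι) (u : 𝓢(E, ℂ)) :
    O.raise k u = coordMul (O.potVec k) u - dirDeriv (O.kinVec k) u := rfl

theorem lower_apply (k : ι) (u : 𝓢(E, ℂ)) :
    O.lower k u = coordMul (O.potVec k) u + dirDeriv (O.kinVec k) u := rfl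

theorem inner_potVec_kinVec [DecidableEq ι] (j k : ι) :
    inner ℝ (O.potVec j) (O.kinVec k) = if j = k then O.kin j * O.freq j else 0 := by
  rw [potVec, kinVec, real_inner_smul_left, real_inner_smul_right, O.basis.inner_eq_ite]
  split_ifs with h
  · subst h
    ring
  · simp

theorem raise_comm (j k : ι) (u : 𝓢(E, ℂ)) : O.raise j (O.raise k u) = O.raise k (O.raise j u) := by
  classical
  have h : inner ℝ (O.potVec j) (O.kinVec k) = inner ℝ (O.potVec k) (O.kinVec j) := by
    rw [inner_potVec_kinVec, inner_potVec_kinVec]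
    by_cases hjk : j = k
    · rw [hjk]
    · rw [if_neg hjk, if_neg (Ne.symm hjk)]
  simp only [raise_apply, map_sub, dirDeriv_coordMul, h]
  rw [coordMul_comm (O.potVec j), dirDeriv_comm (O.kinVec j)]
  abel

/-- Two cross terms each contribute a commutator `κ ω`, hence the factor 2. -/
theorem lower_raise [DecidableEq ι] (j k : ι) (u : 𝓢(E, ℂ)) :
    O.lower j (O.raise k u) = O.raise k (O.lower j u) +
      if j = k then ((2 * (O.kin k * O.freq k) : ℝ) : ℂ) • u else 0 := by
  simp only [raise_apply, lower_apply, map_sub, map_add, dirDeriv_coordMul, inner_potVec_kinVec]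
  rw [coordMul_comm (O.potVec j), dirDeriv_comm (O.kinVec j)]
  by_cases hjk : j = k
  · subst hjk
    simp only [if_true, Complex.ofReal_mul, Complex.ofReal_ofNat]
    module
  · simp only [hjk, Ne.symm hjk, if_false, Complex.ofReal_zero]
    module

/-- Factorisation: `(ωx - κ∂)(ωx + κ∂)` misses the one-dimensional oscillator by the zero-point
energy `κ ω`. -/
theorem ham_apply (u : 𝓢(E, ℂ)) : O.ham u =
    ∑ k, (O.raise k (O.lower k u) + ((O.kin k * O.freq k : ℝ) : ℂ) • u) := by
  classical
  rw [ham, osc_apply']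
  refine Finset.sum_congr rfl fun k _ => ?_
  simp only [raise_apply, lower_apply, map_add, dirDeriv_coordMul, inner_potVec_kinVec, if_true]
  module

/-- The ground state. -/
def ground : 𝓢(E, ℂ) :=
  gaussian O.basis (c := fun k => O.freq k / O.kin k) fun k => div_pos (O.freq_pos k) (O.kin_pos k)

/-- The Gaussian has parameter `ω / κ`, so `κ ∂` acts on it as multiplication by `-ω x`. -/
theorem lower_ground (k : ι) : O.lower k O.ground = 0 := by
  rw [lower_apply, kinVec, potVec, dirDeriv_smul_left, coordMul_smul_left, ground,
    dirDeriv_gaussian, smul_neg, smul_smul, ← Complex.ofReal_mul,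
    mul_div_cancel₀ _ (O.kin_pos k).ne', add_neg_cancel]

theorem ground_ne_zero : O.ground ≠ 0 := by
  intro h
  have := DFunLike.congr_fun h 0
  rw [ground, gaussian_apply] at this
  simp at this

/-- Needed to form ordered-independent products in the noncommutative ring of operators. -/
theorem pairwise_commute_raise : Pairwise fun j k => ∀ x y : Multiplicative ℕ,
    Commute (powersHom (𝓢(E, ℂ) →L[ℂ] 𝓢(E, ℂ)) (O.raise j) x)
      (powersHom (𝓢(E, ℂ) →L[ℂ] 𝓢(E, ℂ)) (O.raise k) y) := fun j k _ x y => by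
  have : Commute (O.raise j) (O.raise k) :=
    ContinuousLinearMap.ext fun u => O.raise_comm j k u
  exact this.pow_pow _ _

/-- The products of powers of the creation operators. -/
def raisePow : (ι → Multiplicative ℕ) →* (𝓢(E, ℂ) →L[ℂ] 𝓢(E, ℂ)) :=
  MonoidHom.noncommPiCoprod (fun k => powersHom _ (O.raise k)) O.pairwise_commute_raise

theorem raisePow_mulSingle [DecidableEq ι] (k : ι) :
    O.raisePow (Pi.mulSingle k (Multiplicative.ofAdd 1)) = O.raise k := by
  rw [raisePow, MonoidHom.noncommPiCoprod_mulSingle]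
  exact pow_one _

/-- The (unnormalised) Hermite function of index `α`. -/
def hermite (α : ι → ℕ) : 𝓢(E, ℂ) :=
  O.raisePow (fun k => Multiplicative.ofAdd (α k)) O.ground

theorem hermite_zero : O.hermite 0 = O.ground := by
  have : (fun k => Multiplicative.ofAdd ((0 : ι → ℕ) k)) = (1 : ι → Multiplicative ℕ) := rfl
  rw [hermite, this, map_one]
  rfl

theorem hermite_add_single [DecidableEq ι] (α : ι → ℕ) (k : ι) :
    O.hermite (α + Pi.single k 1) = O.raise k (O.hermite α) := by
  have : (fun j => Multiplicative.ofAdd ((α + Pi.single k 1 : ι → ℕ) j)) =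
      Pi.mulSingle k (Multiplicative.ofAdd 1) * fun j => Multiplicative.ofAdd (α j) := by
    ext j
    by_cases hj : j = k
    · subst hj
      simp [add_comm]
    · simp [hj]
  rw [hermite, this, map_mul, raisePow_mulSingle]
  rfl

/-- The number operator: commuting `lower k` towards the ground state, each factor `raise k`
contributes `2 κ ω` and the other factors nothing. -/
theorem raise_lower_hermite (α : ι → ℕ) (k : ι) :
    O.raise k (O.lower k (O.hermite α)) =
      ((2 * (O.kin k * O.freq k) * α k : ℝ) : ℂ) • O.hermite α := by
  classical
  induction α using pi_nat_induction with
  | h0 => simp [hermite_zero, lower_ground]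
  | hadd α j ih =>
    rw [hermite_add_single, lower_raise, map_add, raise_comm, ih]
    by_cases hkj : k = j
    · subst hkj
      simp only [if_true, map_smul, Pi.add_apply, Pi.single_eq_same]
      push_cast
      module
    · simp [hkj]

/-- The eigenvalue of the Hermite function of index `α`. -/
def energy (α : ι → ℕ) : ℝ := ∑ k, (2 * (α k : ℝ) + 1) * (O.kin k * O.freq k)

theorem ham_hermite (α : ι → ℕ) : O.ham (O.hermite α) = (O.energy α : ℂ) • O.hermite α := by
  rw [ham_apply, energy, Complex.ofReal_sum, Finset.sum_smul]
  refine Finset.sum_congr rfl fun k _ => ?_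
  rw [raise_lower_hermite, ← add_smul]
  push_cast
  congr 1
  ring

theorem finite_energy_le (C : ℝ) : {α | O.energy α ≤ C}.Finite := by
  refine (Set.Finite.pi' (t := fun k => Set.Iic ⌊C / (O.kin k * O.freq k)⌋₊)
    fun k => Set.finite_Iic _).subset fun α hα k => ?_
  have hpos (k : ι) : 0 < O.kin k * O.freq k := mul_pos (O.kin_pos k) (O.freq_pos k)
  refine Nat.le_floor ((le_div_iff₀ (hpos k)).2 ?_)
  have h1 : (2 * (α k : ℝ) + 1) * (O.kin k * O.freq k) ≤ O.energy α :=
    Finset.single_le_sum (f := fun k => (2 * (α k : ℝ) + 1) * (O.kin k * O.freq k))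
      (fun j _ => mul_nonneg (by positivity) (hpos j).le) (Finset.mem_univ k)
  have h2 : (α k : ℝ) * (O.kin k * O.freq k) ≤ (2 * (α k : ℝ) + 1) * (O.kin k * O.freq k) :=
    mul_le_mul_of_nonneg_right (by linarith [(Nat.cast_nonneg (α k) : (0 : ℝ) ≤ _)]) (hpos k).le
  exact h2.trans (h1.trans hα)

variable [FiniteDimensional ℝ E] [MeasurableSpace E] [BorelSpace E]

theorem inner_raise (k : ι) (u v : 𝓢(E, ℂ)) :
    inner ℂ (toL2 (O.raise k u)) (toL2 v) = inner ℂ (toL2 u) (toL2 (O.lower k v)) := by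
  simp only [raise_apply, lower_apply, map_sub, map_add, inner_sub_left, inner_add_right,
    inner_dirDeriv, inner_coordMul]
  ring

theorem inner_lower (k : ι) (u v : 𝓢(E, ℂ)) :
    inner ℂ (toL2 (O.lower k u)) (toL2 v) = inner ℂ (toL2 u) (toL2 (O.raise k v)) := by
  simp only [raise_apply, lower_apply, map_sub, map_add, inner_sub_right, inner_add_left,
    inner_dirDeriv, inner_coordMul]
  ring

/-- Raising in direction `k` multiplies the squared norm by `2 κ ω (α k + 1)`, which is positive. -/
theorem hermite_ne_zero (α : ι → ℕ) : O.hermite α ≠ 0 := by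
  classical
  induction α using pi_nat_induction with
  | h0 => exact O.hermite_zero ▸ O.ground_ne_zero
  | hadd α k ih =>
    intro h
    have h1 : inner ℂ (toL2 (O.raise k (O.hermite α))) (toL2 (O.raise k (O.hermite α))) = 0 := by
      rw [← hermite_add_single, h, map_zero, inner_zero_left]
    rw [inner_raise, lower_raise, if_pos rfl, raise_lower_hermite, ← add_smul, map_smul,
      inner_smul_right, ← Complex.ofReal_add, mul_eq_zero, inner_self_eq_zero,
      Complex.ofReal_eq_zero] at h1
    rcases h1 with h1 | h1
    · have := mul_pos (O.kin_pos k) (O.freq_pos k)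
      have h2 : 0 < 2 * (O.kin k * O.freq k) * (α k + 1) := by positivity
      exact h2.ne' (by linarith)
    · exact ih (toL2_injective (h1.trans (map_zero _).symm))

/-- The symmetric number operator in a direction where `α` and `β` differ separates them. The total
energy would not do, since distinct indices may share it. -/
theorem inner_hermite {α β : ι → ℕ} (h : α ≠ β) :
    inner ℂ (toL2 (O.hermite α)) (toL2 (O.hermite β)) = 0 := by
  obtain ⟨k, hk⟩ := Function.ne_iff.1 h
  have h1 : inner ℂ (toL2 (O.raise k (O.lower k (O.hermite α)))) (toL2 (O.hermite β)) =
      inner ℂ (toL2 (O.hermite α)) (toL2 (O.raise k (O.lower k (O.hermite β)))) := by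
    rw [inner_raise, inner_lower]
  rw [raise_lower_hermite, raise_lower_hermite, map_smul, map_smul, inner_smul_left,
    inner_smul_right, Complex.conj_ofReal, ← sub_eq_zero, ← sub_mul, ← Complex.ofReal_sub,
    ← mul_sub, mul_eq_zero, Complex.ofReal_eq_zero, mul_eq_zero] at h1
  have := mul_pos (O.kin_pos k) (O.freq_pos k)
  refine h1.resolve_left (not_or.2 ⟨by positivity, ?_⟩)
  exact sub_ne_zero.2 (Nat.cast_injective.ne hk)

end OscillatorData

end BornOppenheimer
end

noncomputable section

/-! ### Completeness of the Hermite functions -/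

namespace BornOppenheimer

section Fourier

open FourierTransform

variable {E : Type*} [NormedAddCommGroup E] [InnerProductSpace ℝ E] [FiniteDimensional ℝ E]
  [MeasurableSpace E] [BorelSpace E]

/-- Every Schwartz function is a Fourier transform, so moving the transform onto `φ` shows that `φ`
vanishes as a distribution. -/
theorem ae_eq_zero_of_fourier_eq_zero {φ : E → ℂ} (hφ : Integrable φ) (h : ∀ v, 𝓕 φ v = 0) :
    φ =ᵐ[volume] 0 := by
  have hmem := memLp_one_iff_integrable.2 hφ
  have hzero : Lp.toTemperedDistributionCLM ℂ (volume : Measure E) 1 (hmem.toLp φ) = 0 := by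
    ext ψ
    refine (Lp.toTemperedDistribution_apply (μ := (volume : Measure E)) _ ψ).trans ?_
    have h1 : ∫ x, 𝓕 (𝓕⁻ ψ : 𝓢(E, ℂ)) x • φ x = ∫ x, (𝓕⁻ ψ : 𝓢(E, ℂ)) x • 𝓕 φ x := by
      have h2 := VectorFourier.integral_fourierIntegral_smul_eq_flip (L := innerₗ E)
        Real.continuous_fourierChar continuous_inner
        ((𝓕⁻ ψ : 𝓢(E, ℂ)).integrable (μ := volume)) hφ
      rw [flip_innerₗ] at h2
      exact h2
    simp only [h, smul_zero, integral_zero, FourierTransform.fourier_fourierInv_eq] at h1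
    refine (integral_congr_ae ?_).trans h1
    filter_upwards [hmem.coeFn_toLp] with x hx
    rw [hx]
  have := LinearMap.ker_eq_bot'.1 (Lp.ker_toTemperedDistributionCLM_eq_bot (F := ℂ) (p := 1)
    (μ := (volume : Measure E))) _ hzero
  exact hmem.coeFn_toLp.symm.trans (this ▸ Lp.coeFn_zero ℂ 1 volume)

theorem hasSum_cexp (z : ℂ) : HasSum (fun n : ℕ => z ^ n / n.factorial) (Complex.exp z) := by
  rw [Complex.exp_eq_exp_ℂ]
  exact NormedSpace.expSeries_div_hasSum_exp z

theorem hasSum_rexp (t : ℝ) : HasSum (fun n : ℕ => t ^ n / n.factorial) (Real.exp t) := by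
  rw [Real.exp_eq_exp_ℝ]
  exact NormedSpace.expSeries_div_hasSum_exp t

/-- If all moments of an exponentially decaying function vanish, the function vanishes. -/
theorem ae_eq_zero_of_moments_eq_zero {φ : E → ℂ} (hφ : AEStronglyMeasurable φ volume)
    (hexp : ∀ v : E, Integrable fun x => ((Real.exp (inner ℝ v x) : ℝ) : ℂ) * φ x)
    (hmom : ∀ (v : E) (n : ℕ), ∫ x, ((inner ℝ v x : ℝ) : ℂ) ^ n * φ x = 0) :
    φ =ᵐ[volume] 0 := by
  refine ae_eq_zero_of_fourier_eq_zero (by simpa using hexp 0) fun v => ?_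
  rw [Real.fourier_eq']
  set w : E := (2 * Real.pi) • v
  have hw (x : E) : ((-2 * Real.pi * inner ℝ x v : ℝ) : ℂ) * Complex.I =
      -Complex.I * ((inner ℝ w x : ℝ) : ℂ) := by
    rw [real_inner_smul_left, real_inner_comm]
    push_cast
    ring
  -- Since `exp |t| ≤ exp t + exp (-t)`, the hypothesis at `w` and `-w` suffices. This function
  -- dominates the exponential series of the Fourier kernel.
  have hexp_abs : Integrable fun x => Real.exp |inner ℝ w x| * ‖φ x‖ := by
    refine ((hexp w).norm.add (hexp (-w)).norm).mono
      (Continuous.aestronglyMeasurable (by fun_prop) |>.mul hφ.norm) (.of_forall fun x => ?_)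
    simp only [Pi.add_apply, norm_mul, Complex.norm_real, Real.norm_eq_abs, Real.abs_exp,
      abs_norm, inner_neg_left]
    rw [← add_mul, abs_mul, abs_norm]
    exact mul_le_mul_of_nonneg_right ((Real.exp_abs_le _).trans (le_abs_self _)) (norm_nonneg _)
  have hsum (x : E) : HasSum
      (fun n : ℕ => (-Complex.I * ((inner ℝ w x : ℝ) : ℂ)) ^ n / n.factorial * φ x)
      (Complex.exp (-Complex.I * ((inner ℝ w x : ℝ) : ℂ)) * φ x) := by
    exact (hasSum_cexp _).mul_right _
  have hbd (x : E) : HasSum (fun n : ℕ => |inner ℝ w x| ^ n / n.factorial * ‖φ x‖)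
      (Real.exp |inner ℝ w x| * ‖φ x‖) := by
    exact (hasSum_rexp _).mul_right _
  have key := hasSum_integral_of_dominated_convergence (μ := volume)
    (F := fun (n : ℕ) x => (-Complex.I * ((inner ℝ w x : ℝ) : ℂ)) ^ n / n.factorial * φ x)
    (f := fun x => Complex.exp (-Complex.I * ((inner ℝ w x : ℝ) : ℂ)) * φ x)
    (fun (n : ℕ) x => |inner ℝ w x| ^ n / n.factorial * ‖φ x‖)
    (fun n => (Continuous.aestronglyMeasurable (by fun_prop)).mul hφ)
    (fun n => .of_forall fun x => by simp)
    (.of_forall fun x => (hbd x).summable)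
    (hexp_abs.congr (.of_forall fun x => (hbd x).tsum_eq.symm))
    (.of_forall fun x => hsum x)
  have hterm (n : ℕ) :
      ∫ x, (-Complex.I * ((inner ℝ w x : ℝ) : ℂ)) ^ n / n.factorial * φ x = 0 := by
    have (x : E) : (-Complex.I * ((inner ℝ w x : ℝ) : ℂ)) ^ n / n.factorial * φ x =
        ((-Complex.I) ^ n / n.factorial) * (((inner ℝ w x : ℝ) : ℂ) ^ n * φ x) := by ring
    simp only [this]
    rw [integral_const_mul, hmom, mul_zero]
  simp only [hterm] at key
  simp only [hw, smul_eq_mul]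
  exact key.unique hasSum_zero

end Fourier

theorem coordMul_iterate_apply {E : Type*} [NormedAddCommGroup E] [InnerProductSpace ℝ E] (v : E)
    (n : ℕ) (g : 𝓢(E, ℂ)) (x : E) :
    ((coordMul v)^[n] g) x = ((inner ℝ v x : ℝ) : ℂ) ^ n * g x := by
  induction n with
  | zero => simp
  | succ n ih => rw [Function.iterate_succ_apply', coordMul_apply, ih, pow_succ']; ring

/-! ### Density of the Hermite span and the Hilbert basis -/

namespace OscillatorData

variable {ι E : Type*} [Fintype ι] [NormedAddCommGroup E] [InnerProductSpace ℝ E]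
  (O : OscillatorData ι E)

/-- The span of the Hermite functions. -/
def hermiteSpan : Submodule ℂ 𝓢(E, ℂ) := Submodule.span ℂ (Set.range O.hermite)

theorem map_mem_hermiteSpan {L : 𝓢(E, ℂ) →L[ℂ] 𝓢(E, ℂ)}
    (hL : ∀ α, L (O.hermite α) ∈ O.hermiteSpan) {u : 𝓢(E, ℂ)} (hu : u ∈ O.hermiteSpan) :
    L u ∈ O.hermiteSpan := by
  have : O.hermiteSpan ≤ O.hermiteSpan.comap (L : 𝓢(E, ℂ) →ₗ[ℂ] 𝓢(E, ℂ)) :=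
    Submodule.span_le.2 (by rintro _ ⟨α, rfl⟩; exact hL α)
  exact this hu

theorem hermite_mem_hermiteSpan (α : ι → ℕ) : O.hermite α ∈ O.hermiteSpan :=
  Submodule.subset_span ⟨α, rfl⟩

theorem raise_mem_hermiteSpan (k : ι) {u : 𝓢(E, ℂ)} (hu : u ∈ O.hermiteSpan) :
    O.raise k u ∈ O.hermiteSpan := by
  classical
  refine O.map_mem_hermiteSpan (fun α => ?_) hu
  rw [← hermite_add_single]
  exact O.hermite_mem_hermiteSpan _

theorem lower_mem_hermiteSpan (k : ι) {u : 𝓢(E, ℂ)} (hu : u ∈ O.hermiteSpan) :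
    O.lower k u ∈ O.hermiteSpan := by
  classical
  refine O.map_mem_hermiteSpan (fun α => ?_) hu
  induction α using pi_nat_induction with
  | h0 =>
    rw [hermite_zero, lower_ground]
    exact zero_mem _
  | hadd α j ih =>
    rw [hermite_add_single, lower_raise]
    refine add_mem (O.raise_mem_hermiteSpan j ih) ?_
    split_ifs
    · exact Submodule.smul_mem _ _ (O.hermite_mem_hermiteSpan α)
    · exact zero_mem _

theorem coordMul_basis_eq (k : ι) (u : 𝓢(E, ℂ)) : coordMul (O.basis k) u =
    ((2 * O.freq k : ℝ) : ℂ)⁻¹ • (O.raise k u + O.lower k u) := by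
  have h : ((2 * O.freq k : ℝ) : ℂ) ≠ 0 :=
    Complex.ofReal_ne_zero.2 (mul_pos two_pos (O.freq_pos k)).ne'
  rw [eq_inv_smul_iff₀ h, raise_apply, lower_apply, potVec, coordMul_smul_left]
  push_cast
  module

/-- Coordinates are combinations of ladder operators, which preserve the span; hence the span
contains polynomials times the ground state. -/
theorem coordMul_mem_hermiteSpan (v : E) {u : 𝓢(E, ℂ)} (hu : u ∈ O.hermiteSpan) :
    coordMul v u ∈ O.hermiteSpan := by
  have : coordMul v u =
      ∑ k, ((inner ℝ (O.basis k) v : ℝ) : ℂ) • coordMul (O.basis k) u := by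
    ext x
    rw [coordMul_apply, ← O.basis.sum_inner_mul_inner v x]
    simp only [sum_apply, smul_apply, coordMul_apply, smul_eq_mul, Complex.ofReal_sum,
      Complex.ofReal_mul, Finset.sum_mul, real_inner_comm v, mul_assoc]
  rw [this]
  refine Submodule.sum_mem _ fun k _ => Submodule.smul_mem _ _ ?_
  rw [coordMul_basis_eq]
  exact Submodule.smul_mem _ _
    (add_mem (O.raise_mem_hermiteSpan k hu) (O.lower_mem_hermiteSpan k hu))

theorem iterate_coordMul_ground_mem (v : E) (n : ℕ) :
    (coordMul v)^[n] O.ground ∈ O.hermiteSpan := by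
  induction n with
  | zero => exact O.hermite_zero ▸ O.hermite_mem_hermiteSpan 0
  | succ n ih =>
    rw [Function.iterate_succ_apply']
    exact O.coordMul_mem_hermiteSpan v ih

variable [FiniteDimensional ℝ E] [MeasurableSpace E] [BorelSpace E]

/-- Orthogonality to the span kills all moments of `ground * f`, whose exponential weights are
integrable as products of two `L²` functions. The Gaussian has no zeros, so `f` vanishes too. -/
theorem eq_zero_of_inner_hermite_eq_zero {f : Lp ℂ 2 (volume : Measure E)}
    (hf : ∀ α, inner ℂ (toL2 (O.hermite α)) f = 0) : f = 0 := by
  have hspan {u : 𝓢(E, ℂ)} (hu : u ∈ O.hermiteSpan) : inner ℂ (toL2 u) f = 0 := by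
    have : O.hermiteSpan ≤ (LinearMap.ker (innerSL ℂ f : _ →ₗ[ℂ] ℂ)).comap
        (toL2 (E := E)).toLinearMap :=
      Submodule.span_le.2 (by
        rintro _ ⟨α, rfl⟩
        exact inner_eq_zero_symm.1 (hf α))
    exact inner_eq_zero_symm.1 (this hu)
  have hground (x : E) : O.ground x =
      (Real.exp (-(∑ k, O.freq k / O.kin k * inner ℝ (O.basis k) x ^ 2) / 2) : ℂ) :=
    gaussian_apply _ _ x
  have hf2 : MemLp f 2 volume := Lp.memLp f
  have hzero : (fun x => O.ground x * f x) =ᵐ[volume] 0 := by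
    refine ae_eq_zero_of_moments_eq_zero
      (O.ground.continuous.aestronglyMeasurable.mul hf2.1) (fun v => ?_) fun v n => ?_
    · obtain ⟨g, hg⟩ := exists_gaussian_mul_exp O.basis (c := fun k => O.freq k / O.kin k)
        (fun k => div_pos (O.freq_pos k) (O.kin_pos k)) v
      refine ((g.memLp 2 volume).integrable_mul hf2).congr (.of_forall fun x => ?_)
      simp only [Pi.mul_apply]
      rw [hg, hground, ← mul_assoc, ← Complex.ofReal_mul, ← Real.exp_add, sub_eq_add_neg, neg_div]
    · rw [← hspan (O.iterate_coordMul_ground_mem v n), inner_toL2_left,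
        Lp.toTemperedDistribution_apply]
      refine integral_congr_ae (.of_forall fun x => ?_)
      simp only [conjS_apply, coordMul_iterate_apply, map_mul, map_pow, hground,
        Complex.conj_ofReal, smul_eq_mul, mul_assoc]
  rw [Lp.eq_zero_iff_ae_eq_zero]
  filter_upwards [hzero] with x hx
  refine (mul_eq_zero.1 hx).resolve_left ?_
  rw [hground]
  exact Complex.ofReal_ne_zero.2 (Real.exp_ne_zero _)

theorem norm_toL2_hermite_ne_zero (α : ι → ℕ) : ‖toL2 (O.hermite α)‖ ≠ 0 := fun h =>
  O.hermite_ne_zero α (toL2_injective ((norm_eq_zero.1 h).trans (map_zero toL2).symm))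

/-- The normalised Hermite functions. -/
def hermiteN (α : ι → ℕ) : 𝓢(E, ℂ) := ((‖toL2 (O.hermite α)‖ : ℂ)⁻¹) • O.hermite α

theorem orthonormal_hermiteN : Orthonormal ℂ fun α => toL2 (O.hermiteN α) := by
  refine ⟨fun α => ?_, fun α β h => ?_⟩
  · change ‖toL2 (O.hermiteN α)‖ = 1
    rw [hermiteN, map_smul, norm_smul, norm_inv, Complex.norm_real, norm_norm,
      inv_mul_cancel₀ (O.norm_toL2_hermite_ne_zero α)]
  · simp only [hermiteN, map_smul, inner_smul_left, inner_smul_right, O.inner_hermite h, mul_zero]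

/-- The Hilbert basis of Hermite functions. -/
def hermiteBasis : HilbertBasis (ι → ℕ) ℂ (Lp ℂ 2 (volume : Measure E)) :=
  HilbertBasis.mkOfOrthogonalEqBot O.orthonormal_hermiteN (by
    refine (Submodule.eq_bot_iff _).2 fun f hf => O.eq_zero_of_inner_hermite_eq_zero fun α => ?_
    have h1 := (Submodule.mem_orthogonal _ _).1 hf _ (Submodule.subset_span ⟨α, rfl⟩)
    simp only [hermiteN, map_smul, inner_smul_left] at h1
    refine (mul_eq_zero.1 h1).resolve_left ?_
    simpa using O.norm_toL2_hermite_ne_zero α)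

theorem hermiteBasis_apply (α : ι → ℕ) : O.hermiteBasis α = toL2 (O.hermiteN α) := by
  rw [hermiteBasis, HilbertBasis.coe_mkOfOrthogonalEqBot]

theorem ham_hermiteN (α : ι → ℕ) : O.ham (O.hermiteN α) = (O.energy α : ℂ) • O.hermiteN α := by
  rw [hermiteN, map_smul, ham_hermite, smul_comm]

end OscillatorData

end BornOppenheimer
end

noncomputable section

/-! ### Regularity of the vectors in the domain of the diagonal operator -/

namespace BornOppenheimer

variable {ι E : Type*} [NormedAddCommGroup E] [InnerProductSpace ℝ E] [FiniteDimensional ℝ E]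
  [MeasurableSpace E] [BorelSpace E]

theorem inner_oscTerm (m l : ι → E) (s : ι ⊕ ι) (f g : 𝓢(E, ℂ)) :
    inner ℂ (toL2 (oscTerm m l s f)) (toL2 g) = inner ℂ (toL2 f) (toL2 (oscTerm m l s g)) := by
  rcases s with k | k
  · simp only [oscTerm_inl, map_neg, inner_neg_left, inner_neg_right, inner_dirDeriv, neg_neg]
  · simp only [oscTerm_inr, inner_coordMul]

open FourierTransform Laplacian in
-- The symbol is `1 + ‖ξ‖²`, while in this Fourier normalisation `Δ` has symbol `-(2π)² ‖ξ‖²`.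
theorem besselPotential_two_eq (u : 𝓢'(E, ℂ)) :
    besselPotential E ℂ 2 u = u - (((2 * Real.pi) ^ 2 : ℝ) : ℂ)⁻¹ • Δ u := by
  have h1 : (fun x : E => (((1 + ‖x‖ ^ 2) ^ ((2 : ℝ) / 2) : ℝ) : ℂ)) =
      (fun _ => (1 : ℂ)) + fun x => ((‖x‖ ^ 2 : ℝ) : ℂ) := by
    ext x
    simp
  have hpi : (((2 * Real.pi) ^ 2 : ℝ) : ℂ) ≠ 0 := Complex.ofReal_ne_zero.2 (by positivity)
  have h2 : Δ u = -((((2 * Real.pi) ^ 2 : ℝ) : ℂ) •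
      fourierMultiplierCLM ℂ (fun x : E => ((‖x‖ ^ 2 : ℝ) : ℂ)) u) := by
    rw [laplacian_eq_fourierMultiplierCLM, neg_smul]
    rfl
  rw [h2, smul_neg, inv_smul_smul₀ hpi, sub_neg_eq_add, besselPotential, h1]
  simp only [fourierMultiplierCLM_apply]
  rw [smulLeftCLM_add (by fun_prop) (by fun_prop)]
  simp only [add_apply, smulLeftCLM_const, one_smul, FourierTransform.fourierInv_add,
    FourierTransform.fourierInv_fourier_eq]

open Laplacian in
theorem memSobolev_two_of_laplacian {u g : Lp ℂ 2 (volume : Measure E)}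
    (h : Δ (u : 𝓢'(E, ℂ)) = (g : 𝓢'(E, ℂ))) : MemSobolev 2 2 (u : 𝓢'(E, ℂ)) := by
  refine ⟨u - (((2 * Real.pi) ^ 2 : ℝ) : ℂ)⁻¹ • g, ?_⟩
  rw [besselPotential_two_eq, h]
  simp only [← Lp.toTemperedDistributionCLM_apply, map_sub, map_smul]

/-- Two locally integrable functions with the same distributional pairings agree. -/
theorem ae_eq_of_integral_schwartz_eq {f g : E → ℂ} (hf : LocallyIntegrable f)
    (hg : LocallyIntegrable g) (h : ∀ ψ : 𝓢(E, ℂ), ∫ x, ψ x * f x = ∫ x, ψ x * g x) :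
    f =ᵐ[volume] g := by
  refine ae_eq_of_integral_contDiff_smul_eq hf hg fun φ hφ hφc => ?_
  have h1 : HasCompactSupport (Complex.ofRealCLM ∘ φ) := hφc.comp_left rfl
  have h2 : ContDiff ℝ ((⊤ : ℕ∞) : WithTop ℕ∞) (Complex.ofRealCLM ∘ φ) :=
    Complex.ofRealCLM.contDiff.comp hφ
  exact h (h1.toSchwartzMap h2)

/-- This upgrades a weak identity to a pointwise one: testing against Schwartz functions determines
a locally integrable function. -/
theorem ae_eq_of_inner_oscTerm_inr {m l : ι → E} {k : ι} {u g : Lp ℂ 2 (volume : Measure E)}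
    (h : ∀ φ, inner ℂ (toL2 φ) g = inner ℂ (toL2 (oscTerm m l (.inr k) φ)) u) :
    g =ᵐ[volume] fun x => ((inner ℝ (l k) x ^ 2 : ℝ) : ℂ) * u x := by
  have hloc (u : Lp ℂ 2 (volume : Measure E)) : LocallyIntegrable u volume :=
    (Lp.memLp u).locallyIntegrable one_le_two
  refine ae_eq_of_integral_schwartz_eq (hloc g) ?_ fun ψ => ?_
  · exact (hloc u).continuous_mul (by fun_prop)
  · have h1 := h (conjS ψ)
    rw [inner_toL2_left, inner_toL2_left, conjS_conjS, Lp.toTemperedDistribution_apply,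
      Lp.toTemperedDistribution_apply] at h1
    refine h1.trans (integral_congr_ae (.of_forall fun x => ?_))
    simp only [conjS_apply, oscTerm_inr, coordMul_apply, map_mul, Complex.conj_ofReal,
      Complex.conj_conj, smul_eq_mul]
    push_cast
    ring

theorem lineDerivOp_sq_of_inner_oscTerm_inl {m l : ι → E} {k : ι}
    {u g : Lp ℂ 2 (volume : Measure E)}
    (h : ∀ φ, inner ℂ (toL2 φ) g = inner ℂ (toL2 (oscTerm m l (.inl k) φ)) u) :
    ∂_{m k} (∂_{m k} (u : 𝓢'(E, ℂ))) = -(g : 𝓢'(E, ℂ)) := by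
  ext ψ
  have h1 := h (conjS ψ)
  rw [inner_toL2_left, inner_toL2_left, conjS_conjS, oscTerm_inl, dirDeriv_conjS,
    dirDeriv_conjS] at h1
  have h2 : conjS (-conjS (dirDeriv (m k) (dirDeriv (m k) ψ))) =
      -dirDeriv (m k) (dirDeriv (m k) ψ) := by
    ext x
    simp
  rw [h2, map_neg] at h1
  rw [neg_apply, h1, neg_neg, lineDerivOp_apply_apply, lineDerivOp_apply_apply, dirDeriv_eq,
    dirDeriv_eq, LineDeriv.lineDerivOp_neg, neg_neg]

namespace OscillatorData

variable [Fintype ι] (O : OscillatorData ι E)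

/-- The summands of the oscillator are closable, and the domain of the diagonal operator is
contained in the domains of their closures. -/
theorem exists_weak_oscTerm {u f : Lp ℂ 2 (volume : Measure E)}
    (huf : ∀ α, inner ℂ (O.hermiteBasis α) f = O.energy α * inner ℂ (O.hermiteBasis α) u)
    (s : ι ⊕ ι) : ∃ g : Lp ℂ 2 (volume : Measure E), ∀ φ,
      inner ℂ (toL2 φ) g = inner ℂ (toL2 (oscTerm O.kinVec O.potVec s φ)) u := by
  let S (F : Finset (ι → ℕ)) : 𝓢(E, ℂ) :=
    ∑ α ∈ F, inner ℂ (O.hermiteBasis α) u • O.hermiteN α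
  have hS : Filter.Tendsto (fun F => toL2 (S F)) Filter.atTop (nhds u) := by
    have := O.hermiteBasis.hasSum_repr u
    refine Filter.Tendsto.congr (fun F => ?_) this
    simp only [S, map_sum, map_smul, HilbertBasis.repr_apply_apply, hermiteBasis_apply]
  have hH : Filter.Tendsto (fun F => toL2 (O.ham (S F))) Filter.atTop (nhds f) := by
    have := O.hermiteBasis.hasSum_repr f
    refine Filter.Tendsto.congr (fun F => ?_) this
    simp only [S, map_sum, map_smul, HilbertBasis.repr_apply_apply, ham_hermiteN, huf, smul_smul]
    simp only [hermiteBasis_apply, mul_comm]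
  obtain ⟨C, hC, hle⟩ := exists_norm_oscTerm_le O.kinVec O.potVec
  -- The separation estimate applied to differences of the Schwartz partial sums: convergence of `S
  -- F` and of `O.ham (S F)` controls each summand.
  have hcauchy : CauchySeq fun F => toL2 (oscTerm O.kinVec O.potVec s (S F)) := by
    rw [cauchySeq_iff_tendsto_dist_atTop_0]
    have h1 := cauchySeq_iff_tendsto_dist_atTop_0.1 hS.cauchySeq
    have h2 := cauchySeq_iff_tendsto_dist_atTop_0.1 hH.cauchySeq
    have h3 := h2.add (h1.const_mul C)
    rw [mul_zero, add_zero] at h3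
    refine squeeze_zero (fun _ => dist_nonneg) (fun p => ?_) h3
    have := hle (S p.1 - S p.2) s
    simpa only [dist_eq_norm, map_sub, ham] using this
  obtain ⟨g, hg⟩ := cauchySeq_tendsto_of_complete hcauchy
  refine ⟨g, fun φ => ?_⟩
  have h1 := ((innerSL ℂ (toL2 φ)).continuous.tendsto g).comp hg
  have h2 := ((innerSL ℂ (toL2 (oscTerm O.kinVec O.potVec s φ))).continuous.tendsto u).comp hS
  -- Each summand is symmetric on Schwartz functions, so the two pairings agree before the limit.
  refine tendsto_nhds_unique h1 (h2.congr fun F => ?_)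
  exact inner_oscTerm _ _ _ _ _

variable {u f : Lp ℂ 2 (volume : Measure E)}
  (huf : ∀ α, inner ℂ (O.hermiteBasis α) f = O.energy α * inner ℂ (O.hermiteBasis α) u)

include huf

open Laplacian in
-- Each scaled second derivative is in `L²` separately; removing the factors `κ²` puts the full
-- Laplacian in `L²`, which suffices for `H²`.
theorem memSobolev_two : MemSobolev 2 2 (u : 𝓢'(E, ℂ)) := by
  choose g hg using fun k => O.exists_weak_oscTerm huf (.inl k)
  refine memSobolev_two_of_laplacian (g := ∑ k, -(((O.kin k : ℂ) ^ 2)⁻¹ • g k)) ?_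
  rw [laplacian_eq_sum O.basis]
  simp only [← Lp.toTemperedDistributionCLM_apply, map_sum, map_neg, map_smul]
  refine Finset.sum_congr rfl fun k _ => ?_
  have hk := lineDerivOp_sq_of_inner_oscTerm_inl (hg k)
  have hne : (O.kin k : ℂ) ^ 2 ≠ 0 := pow_ne_zero 2 (Complex.ofReal_ne_zero.2 (O.kin_pos k).ne')
  rw [← smul_neg, eq_inv_smul_iff₀ hne]
  refine Eq.trans ?_ hk
  simp only [kinVec, LineDeriv.lineDerivOp_left_smul, LineDeriv.lineDerivOp_smul, smul_smul,
    Lp.toTemperedDistributionCLM_apply, sq]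
  rw [← Complex.ofReal_mul]
  rfl

theorem memLp_potential : MemLp
    (fun x => ((∑ k, O.freq k ^ 2 * inner ℝ (O.basis k) x ^ 2 : ℝ) : ℂ) * u x) 2 volume := by
  have h (k : ι) : MemLp
      (fun x => ((O.freq k ^ 2 * inner ℝ (O.basis k) x ^ 2 : ℝ) : ℂ) * u x) 2 volume := by
    obtain ⟨g, hg⟩ := O.exists_weak_oscTerm huf (.inr k)
    refine (memLp_congr_ae (ae_eq_of_inner_oscTerm_inr hg)).1 (Lp.memLp g) |>.ae_eq
      (.of_forall fun x => ?_)
    simp only [potVec, real_inner_smul_left, mul_pow]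
  have := memLp_finsetSum Finset.univ fun k _ => h k
  refine this.ae_eq (.of_forall fun x => ?_)
  simp only [Complex.ofReal_sum, Finset.sum_mul]

end OscillatorData

end BornOppenheimer
end

noncomputable section

/-! ### The Hamiltonian of the harmonic oscillator in normal coordinates -/

namespace BornOppenheimer

section Kinetic

open TensorProduct in
/-- The sum of the second derivatives along the image of an orthonormal basis does not depend on the
orthonormal basis. -/
theorem sum_lineDerivOp_sq_eq {F E ι κ : Type*} [NormedAddCommGroup F] [InnerProductSpace ℝ F]
    [FiniteDimensional ℝ F] [NormedAddCommGroup E] [InnerProductSpace ℝ E] [Fintype ι] [Fintype κ]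
    (T : F →ₗ[ℝ] E) (b : OrthonormalBasis ι ℝ F) (b' : OrthonormalBasis κ ℝ F) (f : 𝓢'(E, ℂ)) :
    ∑ i, ∂_{T (b i)} (∂_{T (b i)} f) = ∑ i, ∂_{T (b' i)} (∂_{T (b' i)} f) := by
  let B : F →ₗ[ℝ] F →ₗ[ℝ] 𝓢'(E, ℂ) := (LineDeriv.bilinearLineDerivTwo ℝ f).compl₁₂ T T
  -- Both sums are values of the linear map induced by `B` at the canonical tensor, which has the
  -- same expansion in every orthonormal basis.
  have h := InnerProductSpace.canonicalCovariantTensor_eq_sum F b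
  rw [InnerProductSpace.canonicalCovariantTensor_eq_sum F b'] at h
  have h2 := congrArg (TensorProduct.lift B) h
  simp only [map_sum, TensorProduct.lift.tmul] at h2
  exact h2.symm

variable {n p : ℕ}

/-- The weight is constant on each factor, so the `x` and `y` axes may be rotated independently. -/
theorem kinetic_eq (h : ℝ) (bX : OrthonormalBasis (Fin n) ℝ (EuclideanSpace ℝ (Fin n)))
    (bY : OrthonormalBasis (Fin p) ℝ (EuclideanSpace ℝ (Fin p))) (f : 𝓢'(Config n p, ℂ)) :
    kinetic h f = -((h : ℂ) ^ 2 • ∑ i, ∂_{bX.prod bY (.inl i)} (∂_{bX.prod bY (.inl i)} f)) -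
      ∑ j, ∂_{bX.prod bY (.inr j)} (∂_{bX.prod bY (.inr j)} f) := by
  have hX := sum_lineDerivOp_sq_eq
    ((WithLp.linearEquiv 2 ℝ _).symm.toLinearMap ∘ₗ LinearMap.inl ℝ (EuclideanSpace ℝ (Fin n))
      (EuclideanSpace ℝ (Fin p))) (EuclideanSpace.basisFun (Fin n) ℝ) bX f
  have hY := sum_lineDerivOp_sq_eq
    ((WithLp.linearEquiv 2 ℝ _).symm.toLinearMap ∘ₗ LinearMap.inr ℝ (EuclideanSpace ℝ (Fin n))
      (EuclideanSpace ℝ (Fin p))) (EuclideanSpace.basisFun (Fin p) ℝ) bY f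
  simp only [EuclideanSpace.basisFun_apply] at hX hY
  have hl (i : Fin n) : bX.prod bY (.inl i) = WithLp.toLp 2 (bX i, 0) := by
    rw [OrthonormalBasis.prod_apply]
    rfl
  have hr (j : Fin p) : bX.prod bY (.inr j) = WithLp.toLp 2 (0, bY j) := by
    rw [OrthonormalBasis.prod_apply]
    rfl
  simp only [hl, hr]
  exact congrArg₂ (fun a b => -((h : ℂ) ^ 2 • a) - b) hX hY

end Kinetic

/-! ### Coefficients of the Hamiltonian in the Hermite basis -/

section Coefficients

variable {n p : ℕ} {h : ℝ} {V : Config n p → ℝ} {ι : Type*} [Fintype ι]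
  {O : OscillatorData ι (Config n p)}
  (hkin : ∀ f : 𝓢'(Config n p, ℂ), kinetic h f = -∑ k, ∂_{O.kinVec k} (∂_{O.kinVec k} f))
  (hV : ∀ z, V z = ∑ k, O.freq k ^ 2 * inner ℝ (O.basis k) z ^ 2)

include hkin in
-- By definition of the distributional derivative, both derivatives fall on the Schwartz function.
theorem inner_kineticL2 (φ : 𝓢(Config n p, ℂ)) (u : hamiltonianDomain n p V) :
    inner ℂ (toL2 φ) (kineticL2 h u) =
      ∑ k, inner ℂ (toL2 (oscTerm O.kinVec O.potVec (.inl k) φ)) (u : L2 n p) := by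
  have hterm (k : ι) : inner ℂ (toL2 (oscTerm O.kinVec O.potVec (.inl k) φ)) (u : L2 n p) =
      -((∂_{O.kinVec k} (∂_{O.kinVec k} ((u : L2 n p) : 𝓢'(Config n p, ℂ)))) (conjS φ)) := by
    rw [lineDerivOp_apply_apply, lineDerivOp_apply_apply, LineDeriv.lineDerivOp_neg, neg_neg,
      oscTerm_inl, map_neg, inner_neg_left, inner_toL2_left, ← dirDeriv_conjS, ← dirDeriv_conjS,
      dirDeriv_eq, dirDeriv_eq]
  simp only [hterm]
  rw [inner_toL2_left, ← kineticL2_spec, hkin, neg_apply, sum_apply, Finset.sum_neg_distrib]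

include hV in
theorem inner_toLp_potential (φ : 𝓢(Config n p, ℂ)) (u : hamiltonianDomain n p V) :
    inner ℂ (toL2 φ) (u.2.2.toLp _) =
      ∑ k, inner ℂ (toL2 (oscTerm O.kinVec O.potVec (.inr k) φ)) (u : L2 n p) := by
  rw [← sum_inner, ← map_sum, inner_toL2_left, inner_toL2_left, Lp.toTemperedDistribution_apply,
    Lp.toTemperedDistribution_apply]
  refine integral_congr_ae ?_
  filter_upwards [u.2.2.coeFn_toLp] with z hz
  rw [hz, hV]
  simp only [conjS_apply, sum_apply, oscTerm_inr, coordMul_apply, smul_eq_mul,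
    OscillatorData.potVec, real_inner_smul_left, map_sum, map_mul, Complex.conj_ofReal,
    Complex.ofReal_sum, Finset.sum_mul, Finset.mul_sum]
  refine Finset.sum_congr rfl fun k _ => ?_
  push_cast
  ring

include hkin hV

theorem inner_hermiteBasis_kineticL2_add (u : hamiltonianDomain n p V) (α : ι → ℕ) :
    inner ℂ (O.hermiteBasis α) (kineticL2 h u + u.2.2.toLp _) =
      O.energy α * inner ℂ (O.hermiteBasis α) (u : L2 n p) := by
  rw [inner_add_right, O.hermiteBasis_apply, inner_kineticL2 hkin, inner_toLp_potential hV,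
    ← Fintype.sum_sum_type fun s =>
      inner ℂ (toL2 (oscTerm O.kinVec O.potVec s (O.hermiteN α))) (u : L2 n p),
    ← sum_inner, ← map_sum, ← osc_apply]
  change inner ℂ (toL2 (O.ham (O.hermiteN α))) (u : L2 n p) = _
  rw [O.ham_hermiteN, map_smul, inner_smul_left, Complex.conj_ofReal]

theorem inner_hermiteBasis_hamiltonian (u : (hamiltonian n p h V).domain) (α : ι → ℕ) :
    inner ℂ (O.hermiteBasis α) (hamiltonian n p h V u) =
      O.energy α * inner ℂ (O.hermiteBasis α) (u : L2 n p) :=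
  inner_hermiteBasis_kineticL2_add hkin hV u α

omit hkin in
theorem mem_hamiltonian_domain {u f : L2 n p}
    (huf : ∀ α, inner ℂ (O.hermiteBasis α) f = O.energy α * inner ℂ (O.hermiteBasis α) u) :
    u ∈ (hamiltonian n p h V).domain := by
  refine ⟨O.memSobolev_two huf, ?_⟩
  simp only [hV]
  exact O.memLp_potential huf

theorem hamiltonian_opSpectrum_eq :
    opSpectrum (hamiltonian n p h V) = {z | ∃ α, (O.energy α : ℂ) = z} :=
  opSpectrum_eq_range (inner_hermiteBasis_hamiltonian hkin hV)
    (fun _ _ => mem_hamiltonian_domain hV) O.finite_energy_le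

theorem hamiltonian_opSpectrum_eq_discreteSpectrum :
    opSpectrum (hamiltonian n p h V) = discreteSpectrum (hamiltonian n p h V) :=
  opSpectrum_eq_discreteSpectrum (inner_hermiteBasis_hamiltonian hkin hV)
    (fun _ _ => mem_hamiltonian_domain hV) O.finite_energy_le

end Coefficients

/-! ### Quadratic forms with a prescribed list of eigenvalues -/

section Diagonalization

/-- Equal multisets have fibres of equal cardinality, and bijections of the fibres glue. This
matches the given listing of eigenvalues with that of the eigenvector basis. -/
theorem exists_perm_of_map_univ_eq {ι β : Type*} [Fintype ι] {f g : ι → β}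
    (h : Finset.univ.val.map f = Finset.univ.val.map g) :
    ∃ σ : Equiv.Perm ι, ∀ i, g (σ i) = f i := by
  classical
  have hcard (c : β) : Fintype.card {i // f i = c} = Fintype.card {i // g i = c} := by
    have := congrArg (Multiset.count c) h
    rw [Multiset.count_map, Multiset.count_map] at this
    simpa [Fintype.card_subtype, Finset.card_def, eq_comm] using this
  exact ⟨Equiv.ofFiberEquiv fun c => Fintype.equivOfCardEq (hcard c),
    fun i => Equiv.ofFiberEquiv_map _ i⟩

/-- Diagonalisation of a symmetric matrix with prescribed eigenvalues. -/
theorem exists_orthonormalBasis_quadForm {n : ℕ} {A : Matrix (Fin n) (Fin n) ℝ}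
    (hA : A.IsHermitian) {d : Fin n → ℝ} (hd : A.charpoly.roots = Finset.univ.val.map d) :
    ∃ b : OrthonormalBasis (Fin n) ℝ (EuclideanSpace ℝ (Fin n)), ∀ x : EuclideanSpace ℝ (Fin n),
      (A *ᵥ x.ofLp) ⬝ᵥ x.ofLp = ∑ i, d i * inner ℝ (b i) x ^ 2 := by
  rw [hA.roots_charpoly_eq_eigenvalues] at hd
  obtain ⟨σ, hσ⟩ := exists_perm_of_map_univ_eq hd
  refine ⟨hA.eigenvectorBasis.reindex σ, fun x => ?_⟩
  have h1 : ∑ i, d i * inner ℝ (hA.eigenvectorBasis.reindex σ i) x ^ 2 =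
      ∑ i, hA.eigenvalues i * inner ℝ (hA.eigenvectorBasis i) x ^ 2 := by
    refine (Equiv.sum_comp σ _).symm.trans (Finset.sum_congr rfl fun i _ => ?_)
    rw [hσ]
    simp
  have h2 : x.ofLp = ∑ i, inner ℝ (hA.eigenvectorBasis i) x • (hA.eigenvectorBasis i).ofLp := by
    conv_lhs => rw [← hA.eigenvectorBasis.sum_repr' x]
    simp
  have h3 (i : Fin n) : (hA.eigenvectorBasis i).ofLp ⬝ᵥ x.ofLp =
      inner ℝ (hA.eigenvectorBasis i) x := by
    rw [EuclideanSpace.inner_eq_star_dotProduct, dotProduct_comm]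
    simp
  rw [h1]
  -- Both copies of `x` get expanded; the second is folded back once the sum has passed through `A`.
  conv_lhs => rw [h2, Matrix.mulVec_sum, ← h2, sum_dotProduct]
  refine Finset.sum_congr rfl fun i _ => ?_
  rw [Matrix.mulVec_smul, hA.mulVec_eigenvectorBasis, smul_dotProduct, smul_dotProduct, h3]
  simp only [smul_eq_mul]
  ring

end Diagonalization

end BornOppenheimer
end

/-! ### Normal coordinates for the given potential, and the conclusion -/

noncomputable section

namespace BornOppenheimer

variable {n p : ℕ}

/-- The oscillator data of `-h² Δ_x - Δ_y + V` in normal coordinates. -/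
def configOscillator (bX : OrthonormalBasis (Fin n) ℝ (EuclideanSpace ℝ (Fin n)))
    (bY : OrthonormalBasis (Fin p) ℝ (EuclideanSpace ℝ (Fin p))) {h : ℝ} (hh : 0 < h)
    {w : Fin n → ℝ} {μ : Fin p → ℝ} (hw : ∀ i, 0 < w i) (hμ : ∀ j, 0 < μ j) :
    OscillatorData (Fin n ⊕ Fin p) (Config n p) where
  basis := bX.prod bY
  kin := Sum.elim (fun _ => h) fun _ => 1
  freq := Sum.elim w μ
  kin_pos := by rintro (i | j) <;> simp [hh]
  freq_pos := by rintro (i | j) <;> simp [hw, hμ]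

variable (bX : OrthonormalBasis (Fin n) ℝ (EuclideanSpace ℝ (Fin n)))
  (bY : OrthonormalBasis (Fin p) ℝ (EuclideanSpace ℝ (Fin p))) {h : ℝ} (hh : 0 < h)
  {w : Fin n → ℝ} {μ : Fin p → ℝ} (hw : ∀ i, 0 < w i) (hμ : ∀ j, 0 < μ j)

theorem kinetic_eq_configOscillator (f : 𝓢'(Config n p, ℂ)) :
    kinetic h f = -∑ k, ∂_{(configOscillator bX bY hh hw hμ).kinVec k}
      (∂_{(configOscillator bX bY hh hw hμ).kinVec k} f) := by
  rw [kinetic_eq h bX bY, Fintype.sum_sum_type, neg_add, ← sub_eq_add_neg, Finset.smul_sum]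
  refine congrArg₂ (fun a b => -a - b) (Finset.sum_congr rfl fun i _ => ?_)
    (Finset.sum_congr rfl fun j _ => ?_)
  · simp only [OscillatorData.kinVec, configOscillator, Sum.elim_inl,
      LineDeriv.lineDerivOp_left_smul, LineDeriv.lineDerivOp_smul, smul_smul, sq]
    rw [← Complex.ofReal_mul]
    rfl
  · simp only [OscillatorData.kinVec, configOscillator, Sum.elim_inr, one_smul]

theorem sum_configOscillator_potential (z : Config n p) :
    ∑ k, (configOscillator bX bY hh hw hμ).freq k ^ 2 *
      inner ℝ ((configOscillator bX bY hh hw hμ).basis k) z ^ 2 =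
    ∑ i, w i ^ 2 * inner ℝ (bX i) z.fst ^ 2 + ∑ j, μ j ^ 2 * inner ℝ (bY j) z.snd ^ 2 := by
  rw [Fintype.sum_sum_type]
  congr 1 <;> refine Finset.sum_congr rfl fun k _ => ?_ <;>
    simp [configOscillator, OrthonormalBasis.prod_apply, WithLp.prod_inner_apply]

theorem energy_configOscillator (α : Fin n ⊕ Fin p → ℕ) :
    (configOscillator bX bY hh hw hμ).energy α =
      ∑ i, (2 * (α (.inl i) : ℝ) + 1) * h * w i + ∑ j, (2 * (α (.inr j) : ℝ) + 1) * μ j := by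
  simp only [OscillatorData.energy, configOscillator, Fintype.sum_sum_type, Sum.elim_inl,
    Sum.elim_inr, one_mul, mul_assoc]

end BornOppenheimer

end
/-- Spectrum of the harmonic oscillator `H(h) = -h² Δ_x - Δ_y + ⟨A x, x⟩ + ⟨B y, y⟩` on
`L²(ℝⁿ × ℝᵖ)`; `w i ^ 2` and `μ j ^ 2` list the eigenvalues of `A` and `B` with multiplicity. -/
theorem mainTheorem6 (n p : ℕ) (h : ℝ) (hh : 0 < h)
    (A : Matrix (Fin n) (Fin n) ℝ) (B : Matrix (Fin p) (Fin p) ℝ)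
    (hA : A.PosDef) (hB : B.PosDef)
    (w : Fin n → ℝ) (μ : Fin p → ℝ) (hw : ∀ i, 0 < w i) (hμ : ∀ j, 0 < μ j)
    (hwA : A.charpoly.roots = Finset.univ.val.map (fun i => w i ^ 2))
    (hμB : B.charpoly.roots = Finset.univ.val.map (fun j => μ j ^ 2)) :
    BornOppenheimer.opSpectrum
        (BornOppenheimer.hamiltonian n p h (BornOppenheimer.harmonicPotential A B)) =
      BornOppenheimer.discreteSpectrum
        (BornOppenheimer.hamiltonian n p h (BornOppenheimer.harmonicPotential A B)) ∧
    BornOppenheimer.opSpectrum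
        (BornOppenheimer.hamiltonian n p h (BornOppenheimer.harmonicPotential A B)) =
      {z : ℂ | ∃ (k : Fin n → ℕ) (m : Fin p → ℕ),
        z = ((∑ i, (2 * (k i : ℝ) + 1) * h * w i + ∑ j, (2 * (m j : ℝ) + 1) * μ j : ℝ) : ℂ)} := by
  obtain ⟨bX, hbX⟩ := BornOppenheimer.exists_orthonormalBasis_quadForm hA.isHermitian hwA
  obtain ⟨bY, hbY⟩ := BornOppenheimer.exists_orthonormalBasis_quadForm hB.isHermitian hμB
  have hkin := BornOppenheimer.kinetic_eq_configOscillator bX bY hh hw hμ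
  have hV (z : BornOppenheimer.Config n p) : BornOppenheimer.harmonicPotential A B z =
      ∑ k, (BornOppenheimer.configOscillator bX bY hh hw hμ).freq k ^ 2 *
        inner ℝ ((BornOppenheimer.configOscillator bX bY hh hw hμ).basis k) z ^ 2 := by
    rw [BornOppenheimer.sum_configOscillator_potential, BornOppenheimer.harmonicPotential, hbX, hbY]
  refine ⟨BornOppenheimer.hamiltonian_opSpectrum_eq_discreteSpectrum hkin hV, ?_⟩
  rw [BornOppenheimer.hamiltonian_opSpectrum_eq hkin hV]
  ext z
  simp only [BornOppenheimer.energy_configOscillator, Set.mem_ofPred_eq]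
  constructor
  · rintro ⟨α, rfl⟩
    exact ⟨fun i => α (.inl i), fun j => α (.inr j), rfl⟩
  · rintro ⟨k, m, rfl⟩
    exact ⟨Sum.elim k m, rfl⟩
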